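/- Let $F\subset\mathbb{P}^2=\mathbb{P}^2_{\mathbb{C}}$ be the Fermat cubic $x^3+y^3+z^3=0$. A hyperosculating conic of $F$ is a conic $Q\subset\mathbb{P}^2$ for which there is a smooth point $p\in F$, not an inflection point of $F$, such that the intersection multiplicity satisfies $(F,Q)_p\ge 6$. (An inflection point is a smooth point $p\in F$ at which the tangent line $T_pF$ satisfies $(F,T_pF)_p\ge 3$.) Let $\omega$ be a primitive third root of unity, let $g_1(x:y:z)=(\omega x:y:z)$ and $g_2(x:y:z)=(x:\omega y:z)$, let $G=\langle g_1,g_2\rangle\cong\mathbb{Z}/3\times\mathbb{Z}/3$, let $\gamma$ be a $3$-cycle in the symmetric group $\mathcal{S}_3$ acting on $\mathbb{P}^2$ by permutation of the coordinates, and let $G'=\langle G,\gamma\rangle\cong G\rtimes\langle\gamma\rangle$, a group of automorphisms of $\mathbb{P}^2$, that is, a subgroup of $\mathrm{PGL}_3(\mathbb{C})$. An element $t\in G'$ acts on conics by sending $\{q=0\}$ to $\{q\circ t^{-1}=0\}$. Then $F$ has exactly $27$ hyperosculating conics; the group $G'$ maps the set of hyperosculating conics of $F$ to itself and acts freely on it;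 $G'$ also acts freely on the set of unordered pairs of distinct hyperosculating conics of $F$; and the number of $G'$-orbits on this set of pairs is exactly $13$. -/

import Mathlib

open scoped LinearAlgebra.Projectivization MatrixGroups Pointwise

namespace FermatConics

noncomputable section

/-- The complex projective plane. -/
abbrev Plane : Type := ℙ ℂ (Fin 3 → ℂ)

/-- The coordinate ring `ℂ[x, y, z]`, with `x = X 0`, `y = X 1`, `z = X 2`. -/
abbrev CoordRing : Type := MvPolynomial (Fin 3) ℂ

/-- The homogeneous prime ideal of a point `p` of the plane: all polynomials vanishing on the line
through the origin that `p` represents. -/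
def pointIdeal (p : Plane) : Ideal CoordRing :=
  MvPolynomial.vanishingIdeal ℂ (p.submodule : Set (Fin 3 → ℂ))

/-- The restriction of a polynomial to the line spanned by a representative of `p`. -/
def restrictToLine (p : Plane) : CoordRing →ₐ[ℂ] Polynomial ℂ :=
  MvPolynomial.aeval fun i => Polynomial.C (p.rep i) * Polynomial.X

lemma eval_restrictToLine (p : Plane) (a : ℂ) (f : CoordRing) :
    (restrictToLine p f).eval a = MvPolynomial.aeval (a • p.rep) f := by
  have h : (Polynomial.aeval a).comp (restrictToLine p) = MvPolynomial.aeval (a • p.rep) := by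
    ext i
    rw [AlgHom.comp_apply, restrictToLine, MvPolynomial.aeval_X, MvPolynomial.aeval_X,
      map_mul, Polynomial.aeval_C, Polynomial.aeval_X, Pi.smul_apply, smul_eq_mul, mul_comm]
    rfl
  simpa [Polynomial.aeval_def, Polynomial.eval₂_eq_eval_map] using DFunLike.congr_fun h f

lemma pointIdeal_eq_ker (p : Plane) : pointIdeal p = RingHom.ker (restrictToLine p) := by
  ext f
  rw [pointIdeal, MvPolynomial.mem_vanishingIdeal_iff, RingHom.mem_ker]
  constructor
  · intro h
    apply Polynomial.funext
    intro a
    rw [eval_restrictToLine, Polynomial.eval_zero]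
    apply h
    rw [Projectivization.submodule_eq]
    exact Submodule.smul_mem _ _ (Submodule.mem_span_singleton_self _)
  · intro h v hv
    rw [Projectivization.submodule_eq] at hv
    obtain ⟨a, rfl⟩ := Submodule.mem_span_singleton.1 hv
    rw [← eval_restrictToLine, h, Polynomial.eval_zero]

instance pointIdeal_isPrime (p : Plane) : (pointIdeal p).IsPrime := by
  rw [pointIdeal_eq_ker]
  exact RingHom.ker_isPrime _

/-- The intersection multiplicity `(C, D)_p` of the plane curves `C : f = 0` and `D : g = 0` at the
point `p`: the length of `S_𝔭 / (f, g)` over the local ring `S_𝔭`, where `S = ℂ[x, y, z]` and `𝔭` is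
the homogeneous prime ideal of `p` (for homogeneous `f` and `g`). -/
def intersectionMultiplicity (f g : CoordRing) (p : Plane) : ℕ∞ :=
  Module.length (Localization.AtPrime (pointIdeal p))
    (Localization.AtPrime (pointIdeal p) ⧸
      (Ideal.span {f, g}).map (algebraMap CoordRing (Localization.AtPrime (pointIdeal p))))

/-- `p` is a smooth point of the curve `f = 0` (for homogeneous `f`). -/
def IsSmoothPoint (f : CoordRing) (p : Plane) : Prop :=
  MvPolynomial.eval p.rep f = 0 ∧ ∃ i, MvPolynomial.eval p.rep (MvPolynomial.pderiv i f) ≠ 0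

/-- The linear form `f_x(p) x + f_y(p) y + f_z(p) z` defining the projective tangent line of
the curve `f = 0` at a smooth point `p`. -/
def tangentLine (f : CoordRing) (p : Plane) : CoordRing :=
  ∑ i, MvPolynomial.C (MvPolynomial.eval p.rep (MvPolynomial.pderiv i f)) * MvPolynomial.X i

/-- `p` is an inflection point of the curve `f = 0`: a smooth point where the tangent line
meets the curve with multiplicity at least `3`. -/
def IsInflectionPoint (f : CoordRing) (p : Plane) : Prop :=
  IsSmoothPoint f p ∧ 3 ≤ intersectionMultiplicity f (tangentLine f p) p

/-- Ternary quadratic forms over `ℂ`. -/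
abbrev QuadForm : Type := MvPolynomial.homogeneousSubmodule (Fin 3) ℂ 2

/-- Plane conics: nonzero ternary quadratic forms up to nonzero scalars. -/
abbrev Conic : Type := ℙ ℂ QuadForm

/-- `Q` is a hyperosculating conic of the curve `f = 0`: at some point of the curve
that is neither singular nor an inflection point, it meets the curve with multiplicity at
least `6`. -/
def IsHyperosculatingConic (f : CoordRing) (Q : Conic) : Prop :=
  ∃ p : Plane, IsSmoothPoint f p ∧ ¬ IsInflectionPoint f p ∧
    6 ≤ intersectionMultiplicity f (Q.rep : CoordRing) p

/-- The set of hyperosculating conics of the curve `f = 0`. -/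
def hyperosculatingConics (f : CoordRing) : Set Conic := {Q | IsHyperosculatingConic f Q}

/-- The equation `x³ + y³ + z³` of the Fermat cubic. -/
def fermatCubic : CoordRing :=
  MvPolynomial.X 0 ^ 3 + MvPolynomial.X 1 ^ 3 + MvPolynomial.X 2 ^ 3

/-- The substitution `f ↦ f(A (x, y, z))`. -/
def substMatrix (A : Matrix (Fin 3) (Fin 3) ℂ) : CoordRing →ₐ[ℂ] CoordRing :=
  MvPolynomial.aeval fun i => ∑ j, MvPolynomial.C (A i j) * MvPolynomial.X j

lemma substMatrix_X (A : Matrix (Fin 3) (Fin 3) ℂ) (i : Fin 3) :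
    substMatrix A (MvPolynomial.X i) = ∑ j, MvPolynomial.C (A i j) * MvPolynomial.X j := by
  simp [substMatrix]

lemma substMatrix_C (A : Matrix (Fin 3) (Fin 3) ℂ) (a : ℂ) :
    substMatrix A (MvPolynomial.C a) = MvPolynomial.C a :=
  (substMatrix A).commutes a

lemma substMatrix_one : substMatrix 1 = AlgHom.id ℂ CoordRing := by
  ext1 i
  rw [substMatrix_X]
  simp [Matrix.one_apply]

lemma substMatrix_mul (A B : Matrix (Fin 3) (Fin 3) ℂ) :
    substMatrix (A * B) = (substMatrix B).comp (substMatrix A) := by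
  ext1 i
  rw [AlgHom.comp_apply, substMatrix_X, substMatrix_X]
  simp only [map_sum, map_mul, substMatrix_X, substMatrix_C, Matrix.mul_apply, Finset.sum_mul,
    Finset.mul_sum]
  rw [Finset.sum_comm]
  simp only [mul_assoc]

lemma substMatrix_isHomogeneous (A : Matrix (Fin 3) (Fin 3) ℂ) {f : CoordRing} {d : ℕ}
    (hf : f.IsHomogeneous d) : (substMatrix A f).IsHomogeneous d := by
  have h := hf.aeval (n := 1) (fun i => ∑ j, MvPolynomial.C (A i j) * MvPolynomial.X j)
    fun i => MvPolynomial.IsHomogeneous.sum _ _ _ fun j _ => by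
      simpa using
        (MvPolynomial.isHomogeneous_C (Fin 3) (A i j)).mul (MvPolynomial.isHomogeneous_X ℂ j)
  simpa [substMatrix] using h

/-- `GL₃(ℂ)` acts on quadratic forms by `t • q = q ∘ t⁻¹`. -/
instance : DistribMulAction (GL (Fin 3) ℂ) QuadForm where
  smul t q := ⟨substMatrix (t⁻¹ : GL (Fin 3) ℂ) q, substMatrix_isHomogeneous _ q.2⟩
  one_smul q := Subtype.ext <| by
    change substMatrix ((1⁻¹ : GL (Fin 3) ℂ) : Matrix (Fin 3) (Fin 3) ℂ) (q : CoordRing) = q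
    rw [inv_one, Units.val_one, substMatrix_one]; rfl
  mul_smul s t q := Subtype.ext <| by
    change substMatrix (((s * t)⁻¹ : GL (Fin 3) ℂ) : Matrix (Fin 3) (Fin 3) ℂ) (q : CoordRing) =
      substMatrix (s⁻¹ : GL (Fin 3) ℂ) (substMatrix (t⁻¹ : GL (Fin 3) ℂ) q)
    rw [mul_inv_rev, Units.val_mul, substMatrix_mul]; rfl
  smul_zero t := Subtype.ext <| map_zero (substMatrix (t⁻¹ : GL (Fin 3) ℂ))
  smul_add t q r := Subtype.ext <| map_add (substMatrix (t⁻¹ : GL (Fin 3) ℂ)) (q : CoordRing) r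

lemma coe_smul_quadForm (t : GL (Fin 3) ℂ) (q : QuadForm) :
    ((t • q : QuadForm) : CoordRing) = substMatrix (t⁻¹ : GL (Fin 3) ℂ) q := rfl

instance : SMulCommClass (GL (Fin 3) ℂ) ℂ QuadForm where
  smul_comm t a q := Subtype.ext <| map_smul (substMatrix (t⁻¹ : GL (Fin 3) ℂ)) a (q : CoordRing)

lemma substMatrix_scalar (u : ℂ) {f : CoordRing} {d : ℕ} (hf : f.IsHomogeneous d) :
    substMatrix (Matrix.scalar (Fin 3) u) f = u ^ d • f := by
  have h : ∀ i : Fin 3, ∑ j, MvPolynomial.C (Matrix.scalar (Fin 3) u i j) * MvPolynomial.X j =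
      (MvPolynomial.C u * MvPolynomial.X i : CoordRing) := by
    intro i
    rw [Finset.sum_eq_single i (fun j _ hj => by simp [Ne.symm hj]) (by simp)]
    simp
  rw [substMatrix]
  simp only [h]
  rw [f.as_sum, map_sum, Finset.smul_sum]
  refine Finset.sum_congr rfl fun m hm => ?_
  have hd := hf (MvPolynomial.mem_support_iff.1 hm)
  rw [Finsupp.weight_apply, Finsupp.sum_fintype _ _ (by simp)] at hd
  simp only [Pi.one_apply, smul_eq_mul, mul_one] at hd
  rw [MvPolynomial.aeval_monomial, MvPolynomial.monomial_eq]
  rw [Finsupp.prod_fintype _ _ (by simp), Finsupp.prod_fintype _ _ (by simp)]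
  simp only [mul_pow, Finset.prod_mul_distrib, Finset.prod_pow_eq_pow_sum, hd,
    MvPolynomial.algebraMap_eq, MvPolynomial.smul_eq_C_mul, map_pow]
  ring

/-- Scalar matrices act trivially on conics, so the automorphism group `PGL₃(ℂ)` of the plane acts
on conics. On classes of matrices and of forms the action is `[t] • [q] = [q ∘ t⁻¹]`. -/
instance : MulAction PGL(3, ℂ) Conic :=
  Matrix.ProjGenLinGroup.mulActionOfGL fun u => Projectivization.ind fun q hq => by
    rw [Projectivization.smul_mk, Projectivization.mk_eq_mk_iff']
    refine ⟨((u⁻¹ : ℂˣ) : ℂ) ^ 2, Subtype.ext ?_⟩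
    rw [coe_smul_quadForm, ← map_inv]
    exact (substMatrix_scalar _ q.2).symm

/-- The automorphism `(x : y : z) ↦ (a x : b y : c z)` of the plane. -/
def diagAut (a b c : ℂˣ) : PGL(3, ℂ) :=
  Matrix.ProjGenLinGroup.mk <| Matrix.GeneralLinearGroup.mkOfDetNeZero
    (Matrix.diagonal ![(a : ℂ), b, c]) (by simp [Fin.prod_univ_three])

/-- The automorphism of the plane that permutes the coordinates by `σ`. -/
def permAut (σ : Equiv.Perm (Fin 3)) : PGL(3, ℂ) :=
  Matrix.ProjGenLinGroup.mk <| Matrix.GeneralLinearGroup.mkOfDetNeZero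
    (σ.permMatrix ℂ) (by rw [Matrix.det_permutation]; simp)

/-- The group `G ≅ ℤ/3 × ℤ/3` of automorphisms of the plane generated by
`g₁ (x : y : z) = (ω x : y : z)` and `g₂ (x : y : z) = (x : ω y : z)`. -/
def groupG (ω : ℂˣ) : Subgroup PGL(3, ℂ) :=
  Subgroup.closure {diagAut ω 1 1, diagAut 1 ω 1}

/-- The group `G' ≅ G ⋊ ⟨γ⟩` of automorphisms of the plane generated by `G` and the
permutation `γ` of the coordinates. -/
def groupG' (ω : ℂˣ) (γ : Equiv.Perm (Fin 3)) : Subgroup PGL(3, ℂ) :=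
  groupG ω ⊔ Subgroup.zpowers (permAut γ)

/-- Unordered pairs of distinct elements of a set `H`, as two-element subsets of `H`. -/
def unorderedPairs {α : Type*} (H : Set α) : Set (Set α) := {P | P ⊆ H ∧ P.ncard = 2}

end

end FermatConics

open FermatConics

/-! The cubic is diagonal in the cubes of the coordinates. Near a point `v` with no zero coordinate
it is parametrized by `t ↦ vᵢ (1 + aᵢ t)^(1/3)`, where `∑ aᵢ vᵢ³ = 0` and the slopes are not all
equal. Contact orders up to 6 are then vanishing orders along an explicit truncated arc
(`le_intersectionMultiplicity_fermatCubic_iff`). Since the multiplicity is a length over a local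
ring of the affine cone, arcs are spread into cones by a generic scalar.

The inflection points are the points of the cubic with a zero coordinate. At any other point,
sixfold contact with a conic is a 6 × 6 linear system in the coefficients of the conic. Its
determinant is, up to a nonzero constant and powers of the coordinates, the product of the
differences of the cubes of the coordinates. So two coordinates have equal cubes
(`exists_pow_three_eq_of_six_le`), and a monomial symmetry moves the point to `(c : 1 : 1)` with `c³
= -2`, where the conic exists and is unique (`six_le_iff`).

Modulo scalars, `G'` consists of the monomial matrices with cyclic support and cube roots of unity
as entries, and has order 27. It is transitive on the hyperosculating conics. Stabilizers are
trivial: the square terms of the conic at `(c : 1 : 1)` have coefficients `-4/c², 1, 1`, with cubes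
`-16, 1, 1`, so no cyclic shift preserves it. The conics thus form one free orbit. A group of odd
order cannot swap two points of a free orbit, so the `351 = 13 · 27` pairs are permuted freely as
well. -/

namespace FermatConics

/-! ### Local algebra: colength bounds from chains of ideals. -/

section LocalAlgebra

variable {R B : Type*} [CommRing R] [CommRing B]

/-- If the maximal ideal of a local ring is generated by `f` and `u`, then an ideal containing `f`
whose quotient has length at least `n` lies in `(f, u ^ n)`. -/
lemma le_span_pair_pow_of_le_coheight [IsLocalRing R] {f u : R}
    (hm : ∀ x ∈ IsLocalRing.maximalIdeal R, x ∈ Ideal.span {f, u}) (n : ℕ) :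
    ∀ J : Ideal R, f ∈ J → (n : ℕ∞) ≤ Order.coheight J → J ≤ Ideal.span {f, u ^ n} := by
  induction n with
  | zero =>
    intro J _ _
    have : Ideal.span {f, u ^ 0} = ⊤ :=
      (Ideal.eq_top_iff_one _).2 (Ideal.subset_span (by simp))
    rw [this]
    exact le_top
  | succ n ih =>
    intro J hf hJ x hx
    obtain ⟨p, hp, hlen⟩ := Order.exists_series_of_le_coheight J hJ
    have hlt : J < p ⟨1, by omega⟩ := by
      rw [← hp]
      exact p.strictMono (by simp [Fin.lt_def])
    have hle : (n : ℕ∞) ≤ Order.coheight (p ⟨1, by omega⟩) := by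
      have h := Order.rev_index_le_coheight p ⟨1, by omega⟩
      refine le_trans ?_ h
      have h1 : n = (Fin.rev (⟨1, by omega⟩ : Fin (p.length + 1)) : ℕ) := by
        simp [Fin.val_rev, hlen]
      exact_mod_cast h1.le
    have hJ' := ih _ (hlt.le hf) hle
    obtain ⟨a, b, rfl⟩ := Ideal.mem_span_pair.1 (hJ' (hlt.le hx))
    -- If `b` is a nonunit, it is a combination of `f` and `u`, which gains one power of `u`. If `b`
    -- is a unit, then `u ^ n ∈ J`, so `J` already contains `(f, u ^ n)`, and no strictly larger
    -- ideal fits below it.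
    by_cases hb : b ∈ IsLocalRing.maximalIdeal R
    · obtain ⟨c, d, rfl⟩ := Ideal.mem_span_pair.1 (hm b hb)
      exact Ideal.mem_span_pair.2 ⟨a + c * u ^ n, d, by ring⟩
    · exfalso
      have hu : IsUnit b := by simpa using hb
      obtain ⟨b', hb'⟩ := hu.exists_left_inv
      have hun : u ^ n ∈ J := by
        have h : b' * (a * f + b * u ^ n - a * f) ∈ J :=
          J.mul_mem_left _ (J.sub_mem hx (J.mul_mem_left _ hf))
        have h2 : b' * (a * f + b * u ^ n - a * f) = u ^ n := by linear_combination u ^ n * hb'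
        rwa [h2] at h
      refine hlt.not_ge (hJ'.trans (Ideal.span_le.2 ?_))
      rintro y (rfl | rfl)
      exacts [hf, hun]

/-- Pulling back the powers of `t` along a ring homomorphism gives a chain of ideals. -/
lemma le_coheight_comap_span_pow (φ : R →+* B) {t : B} {u : R}
    (hu : ∀ k : ℕ, φ u ^ k ∈ Ideal.span {t ^ k} ∧ φ u ^ k ∉ Ideal.span {t ^ (k + 1)}) (n : ℕ) :
    (n : ℕ∞) ≤ Order.coheight ((Ideal.span {t ^ n}).comap φ) := by
  induction n with
  | zero => simp
  | succ n ih =>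
    have hlt : (Ideal.span {t ^ (n + 1)}).comap φ < (Ideal.span {t ^ n}).comap φ := by
      refine lt_of_le_of_ne (Ideal.comap_mono ?_) fun h => (hu n).2 ?_
      · exact Ideal.span_singleton_le_span_singleton.2 (pow_dvd_pow _ (Nat.le_succ n))
      · have h1 : u ^ n ∈ (Ideal.span {t ^ n}).comap φ := by
          rw [Ideal.mem_comap, map_pow]; exact (hu n).1
        rw [← h, Ideal.mem_comap, map_pow] at h1
        exact h1
    have := Order.coheight_add_one_le hlt
    push_cast
    exact le_trans (by gcongr) this

end LocalAlgebra

/-! ### Intersection multiplicity and vanishing order along arcs. -/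

noncomputable section

lemma eval₂Hom_mul_of_isHomogeneous {R S σ : Type*} [CommSemiring R] [CommSemiring S] [Fintype σ]
    (φ : R →+* S) (c : S) (x : σ → S) {f : MvPolynomial σ R} {d : ℕ} (hf : f.IsHomogeneous d) :
    MvPolynomial.eval₂Hom φ (fun i => c * x i) f = c ^ d * MvPolynomial.eval₂Hom φ x f := by
  rw [MvPolynomial.coe_eval₂Hom, MvPolynomial.coe_eval₂Hom, MvPolynomial.eval₂_eq',
    MvPolynomial.eval₂_eq', Finset.mul_sum]
  refine Finset.sum_congr rfl fun m hm => ?_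
  have hd := hf (MvPolynomial.mem_support_iff.1 hm)
  rw [Finsupp.weight_apply, Finsupp.sum_fintype _ _ (by simp)] at hd
  simp only [Pi.one_apply, smul_eq_mul, mul_one] at hd
  simp only [mul_pow, Finset.prod_mul_distrib, Finset.prod_pow_eq_pow_sum, hd]
  ring

/-- Allows an arbitrary representative `v` in place of the chosen one, `p.rep`. -/
lemma mem_pointIdeal_mk_iff {v : Fin 3 → ℂ} (hv : v ≠ 0) (f : CoordRing) :
    f ∈ pointIdeal (Projectivization.mk ℂ v hv) ↔
      MvPolynomial.aeval (fun i => Polynomial.C (v i) * Polynomial.X : Fin 3 → Polynomial ℂ) f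
        = 0 := by
  have key : ∀ a : ℂ, (MvPolynomial.aeval
      (fun i => Polynomial.C (v i) * Polynomial.X : Fin 3 → Polynomial ℂ) f).eval a =
      MvPolynomial.aeval (a • v) f := by
    intro a
    have h : (Polynomial.aeval a).comp (MvPolynomial.aeval
        (fun i => Polynomial.C (v i) * Polynomial.X : Fin 3 → Polynomial ℂ)) =
        (MvPolynomial.aeval (a • v) : CoordRing →ₐ[ℂ] ℂ) := by
      ext i
      rw [AlgHom.comp_apply, MvPolynomial.aeval_X, MvPolynomial.aeval_X, map_mul,
        Polynomial.aeval_C, Polynomial.aeval_X, Pi.smul_apply, smul_eq_mul, mul_comm]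
      rfl
    simpa [Polynomial.aeval_def, Polynomial.eval₂_eq_eval_map] using DFunLike.congr_fun h f
  rw [pointIdeal, MvPolynomial.mem_vanishingIdeal_iff, Projectivization.submodule_mk]
  constructor
  · intro h
    apply Polynomial.funext
    intro a
    rw [key, Polynomial.eval_zero]
    exact h _ (Submodule.smul_mem _ _ (Submodule.mem_span_singleton_self _))
  · intro h x hx
    obtain ⟨a, rfl⟩ := Submodule.mem_span_singleton.1 hx
    rw [← key, h, Polynomial.eval_zero]

/-- The field of rational functions on a line through the origin. -/
abbrev LineField : Type := FractionRing (Polynomial ℂ)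

/-- The generic scalar `s`. -/
def genericScalar : LineField := algebraMap (Polynomial ℂ) LineField Polynomial.X

lemma genericScalar_ne_zero : genericScalar ≠ 0 := by
  rw [genericScalar, Ne, FaithfulSMul.algebraMap_eq_zero_iff]
  exact Polynomial.X_ne_zero

/-- Polynomials as power series over the function field of the line. -/
def toSeries : Polynomial ℂ →+* PowerSeries LineField :=
  Polynomial.coeToPowerSeries.ringHom.comp (Polynomial.mapRingHom (algebraMap ℂ LineField))

lemma coeff_toSeries (k : ℕ) (f : Polynomial ℂ) :
    PowerSeries.coeff k (toSeries f) = algebraMap ℂ LineField (f.coeff k) := by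
  simp [toSeries]

/-- Restriction of polynomials to the cone `(s, t) ↦ s w(t)` over a polynomial arc `w`. -/
def coneHom (w : Fin 3 → Polynomial ℂ) : CoordRing →+* PowerSeries LineField :=
  MvPolynomial.eval₂Hom (toSeries.comp Polynomial.C)
    fun i => PowerSeries.C genericScalar * toSeries (w i)

lemma coneHom_of_isHomogeneous (w : Fin 3 → Polynomial ℂ) {f : CoordRing} {d : ℕ}
    (hf : f.IsHomogeneous d) :
    coneHom w f = PowerSeries.C genericScalar ^ d * toSeries (MvPolynomial.aeval w f) := by
  rw [coneHom, eval₂Hom_mul_of_isHomogeneous _ _ _ hf, MvPolynomial.aeval_def,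
    ← MvPolynomial.coe_eval₂Hom, ← RingHom.comp_apply, MvPolynomial.comp_eval₂Hom]
  rfl

lemma constantCoeff_coneHom (w : Fin 3 → Polynomial ℂ) (f : CoordRing) :
    PowerSeries.constantCoeff (coneHom w f) = algebraMap (Polynomial ℂ) LineField
      (MvPolynomial.aeval
        (fun i => Polynomial.C ((w i).eval 0) * Polynomial.X : Fin 3 → Polynomial ℂ) f) := by
  have h : (PowerSeries.constantCoeff).comp (coneHom w) =
      (algebraMap (Polynomial ℂ) LineField).comp (MvPolynomial.aeval
        (fun i => Polynomial.C ((w i).eval 0) * Polynomial.X :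
          Fin 3 → Polynomial ℂ)).toRingHom := by
    apply MvPolynomial.ringHom_ext
    · intro a
      have := coeff_toSeries 0 (Polynomial.C a)
      rw [PowerSeries.coeff_zero_eq_constantCoeff_apply] at this
      simp [coneHom, this, IsScalarTower.algebraMap_apply ℂ (Polynomial ℂ) LineField]
    · intro i
      have := coeff_toSeries 0 (w i)
      rw [PowerSeries.coeff_zero_eq_constantCoeff_apply, Polynomial.coeff_zero_eq_eval_zero] at this
      rw [IsScalarTower.algebraMap_apply ℂ (Polynomial ℂ) LineField] at this
      rw [RingHom.comp_apply, coneHom, MvPolynomial.eval₂Hom_X', map_mul, this,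
        PowerSeries.constantCoeff_C, genericScalar, RingHom.comp_apply, mul_comm]
      change _ = algebraMap (Polynomial ℂ) LineField (MvPolynomial.aeval _ _)
      rw [MvPolynomial.aeval_X, map_mul]
      rfl
  exact DFunLike.congr_fun h f

/-- This is where the generic scalar is needed. The localization also inverts inhomogeneous
polynomials, such as `x - 1` at `(1 : 0 : 0)`, which vanish at some vectors of the line but not on
all of it. At the generic vector of the line they take a nonzero value. -/
lemma isUnit_coneHom {v : Fin 3 → ℂ} (hv : v ≠ 0) {w : Fin 3 → Polynomial ℂ}
    (hw : ∀ i, (w i).eval 0 = v i) (f : (pointIdeal (Projectivization.mk ℂ v hv)).primeCompl) :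
    IsUnit (coneHom w f) := by
  rw [PowerSeries.isUnit_iff_constantCoeff, constantCoeff_coneHom, isUnit_iff_ne_zero, Ne,
    FaithfulSMul.algebraMap_eq_zero_iff]
  have := f.2
  rw [Ideal.mem_primeCompl_iff, mem_pointIdeal_mk_iff] at this
  simpa only [hw] using this

/-- The extension of `coneHom` to the local ring of the plane at `w(0)`. -/
def localConeHom {v : Fin 3 → ℂ} (hv : v ≠ 0) {w : Fin 3 → Polynomial ℂ}
    (hw : ∀ i, (w i).eval 0 = v i) :
    Localization.AtPrime (pointIdeal (Projectivization.mk ℂ v hv)) →+* PowerSeries LineField :=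
  IsLocalization.lift (M := (pointIdeal (Projectivization.mk ℂ v hv)).primeCompl)
    (isUnit_coneHom hv hw)

lemma localConeHom_algebraMap {v : Fin 3 → ℂ} (hv : v ≠ 0) {w : Fin 3 → Polynomial ℂ}
    (hw : ∀ i, (w i).eval 0 = v i) (f : CoordRing) :
    localConeHom hv hw (algebraMap _ _ f) = coneHom w f :=
  IsLocalization.lift_eq _ f

lemma X_pow_dvd_toSeries_iff (n : ℕ) (f : Polynomial ℂ) :
    PowerSeries.X ^ n ∣ toSeries f ↔ Polynomial.X ^ n ∣ f := by
  rw [PowerSeries.X_pow_dvd_iff, Polynomial.X_pow_dvd_iff]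
  simp only [coeff_toSeries, FaithfulSMul.algebraMap_eq_zero_iff]

/-- On a form of degree `d` the generic scalar only contributes its `d`-th power, a unit, so passing
to the cone does not change vanishing orders. -/
lemma X_pow_dvd_coneHom_iff (w : Fin 3 → Polynomial ℂ) {f : CoordRing} {d : ℕ}
    (hf : f.IsHomogeneous d) (n : ℕ) :
    PowerSeries.X ^ n ∣ coneHom w f ↔ Polynomial.X ^ n ∣ MvPolynomial.aeval w f := by
  have hu : IsUnit (PowerSeries.C genericScalar ^ d) := by
    rw [PowerSeries.isUnit_iff_constantCoeff]
    simpa using fun h => absurd h genericScalar_ne_zero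
  rw [coneHom_of_isHomogeneous w hf, hu.dvd_mul_left, X_pow_dvd_toSeries_iff]

/-- Turns lengths into chains of ideals above `(f, g)`, the form in which the local algebra applies.
-/
lemma intersectionMultiplicity_eq_coheight (f g : CoordRing) (p : Plane) :
    intersectionMultiplicity f g p = Order.coheight ((Ideal.span {f, g}).map
      (algebraMap CoordRing (Localization.AtPrime (pointIdeal p)))) :=
  Module.length_quotient

/-- If two homogeneous curves both vanish to order `n` along an arc transversal to the radial
direction, their intersection multiplicity is at least `n`. -/
theorem le_intersectionMultiplicity_of_dvd {v : Fin 3 → ℂ} (hv : v ≠ 0)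
    {w : Fin 3 → Polynomial ℂ} (hw : ∀ i, (w i).eval 0 = v i) (i j : Fin 3)
    (hij : v j * (w i).coeff 1 ≠ v i * (w j).coeff 1) {f g : CoordRing} {d e : ℕ}
    (hf : f.IsHomogeneous d) (hg : g.IsHomogeneous e) (n : ℕ)
    (hfn : Polynomial.X ^ n ∣ MvPolynomial.aeval w f)
    (hgn : Polynomial.X ^ n ∣ MvPolynomial.aeval w g) :
    (n : ℕ∞) ≤ intersectionMultiplicity f g (Projectivization.mk ℂ v hv) := by
  -- This linear form vanishes at `v`, and by `hij` it has a simple zero along `w`. Its `k`-th power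
  -- has order exactly `k`, which makes the chain of pulled-back ideals strict.
  set u : CoordRing := MvPolynomial.C (v j) * MvPolynomial.X i -
    MvPolynomial.C (v i) * MvPolynomial.X j with hu
  have huh : u.IsHomogeneous 1 :=
    (MvPolynomial.isHomogeneous_C_mul_X _ _).sub (MvPolynomial.isHomogeneous_C_mul_X _ _)
  have hX : ∀ k : ℕ, (MvPolynomial.aeval w u ^ k).coeff k =
      (v j * (w i).coeff 1 - v i * (w j).coeff 1) ^ k ∧
      Polynomial.X ^ k ∣ MvPolynomial.aeval w u ^ k := by
    have h1 : Polynomial.X ∣ MvPolynomial.aeval w u := by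
      rw [Polynomial.X_dvd_iff, Polynomial.coeff_zero_eq_eval_zero]
      simp [hu, hw, mul_comm]
    obtain ⟨q, hq⟩ := h1
    have hq0 : q.coeff 0 = v j * (w i).coeff 1 - v i * (w j).coeff 1 := by
      rw [← Polynomial.coeff_X_mul, ← hq]
      simp [hu]
    intro k
    rw [hq, mul_pow, ← hq0]
    refine ⟨?_, dvd_mul_right _ _⟩
    rw [mul_comm, Polynomial.coeff_mul_X_pow', if_pos le_rfl, Nat.sub_self,
      Polynomial.coeff_zero_eq_eval_zero, Polynomial.eval_pow, Polynomial.coeff_zero_eq_eval_zero]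
  rw [intersectionMultiplicity_eq_coheight]
  refine (le_coheight_comap_span_pow (localConeHom hv hw) (t := PowerSeries.X)
    (u := algebraMap _ _ u) (fun k => ?_) n).trans (Order.coheight_anti ?_)
  · have huk : (u ^ k).IsHomogeneous (1 * k) := huh.pow k
    rw [← map_pow, ← map_pow, localConeHom_algebraMap, Ideal.mem_span_singleton,
      Ideal.mem_span_singleton, X_pow_dvd_coneHom_iff w huk, X_pow_dvd_coneHom_iff w huk, map_pow]
    refine ⟨(hX k).2, fun h => ?_⟩
    have := Polynomial.X_pow_dvd_iff.1 h k (Nat.lt_succ_self k)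
    rw [(hX k).1] at this
    exact pow_ne_zero k (sub_ne_zero.2 hij) this
  · rw [Ideal.map_le_iff_le_comap, Ideal.span_le]
    rintro x (rfl | rfl)
    · simpa [Ideal.mem_span_singleton, localConeHom_algebraMap,
        X_pow_dvd_coneHom_iff w hf] using hfn
    · simpa [Ideal.mem_span_singleton, localConeHom_algebraMap,
        X_pow_dvd_coneHom_iff w hg] using hgn

/-- Conversely, if `f` vanishes to order `n` along the arc and `f`, `u` generate the maximal
ideal, where `u` vanishes at the point, then a curve `g` meeting `f` with multiplicity at least
`n` vanishes to order `n` along the arc. -/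
theorem dvd_of_le_intersectionMultiplicity {v : Fin 3 → ℂ} (hv : v ≠ 0)
    {w : Fin 3 → Polynomial ℂ} (hw : ∀ i, (w i).eval 0 = v i) {f g u : CoordRing} {d e : ℕ}
    (hf : f.IsHomogeneous d) (hg : g.IsHomogeneous e) (n : ℕ)
    (hfn : Polynomial.X ^ n ∣ MvPolynomial.aeval w f)
    (hu : u ∈ pointIdeal (Projectivization.mk ℂ v hv))
    (hm : ∀ x ∈ pointIdeal (Projectivization.mk ℂ v hv),
      algebraMap CoordRing (Localization.AtPrime (pointIdeal (Projectivization.mk ℂ v hv))) x ∈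
        Ideal.span {algebraMap CoordRing (Localization.AtPrime
          (pointIdeal (Projectivization.mk ℂ v hv))) f, algebraMap _ _ u})
    (h : (n : ℕ∞) ≤ intersectionMultiplicity f g (Projectivization.mk ℂ v hv)) :
    Polynomial.X ^ n ∣ MvPolynomial.aeval w g := by
  rw [intersectionMultiplicity_eq_coheight] at h
  have hmax : ∀ x ∈ IsLocalRing.maximalIdeal
      (Localization.AtPrime (pointIdeal (Projectivization.mk ℂ v hv))),
      x ∈ Ideal.span {algebraMap CoordRing (Localization.AtPrime
          (pointIdeal (Projectivization.mk ℂ v hv))) f, algebraMap _ _ u} := by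
    intro x hx
    rw [← Localization.AtPrime.map_eq_maximalIdeal] at hx
    refine (Ideal.map_le_iff_le_comap.2 fun y hy => ?_) hx
    exact hm y hy
  have hJ := le_span_pair_pow_of_le_coheight hmax n _
    (Ideal.mem_map_of_mem _ (Ideal.subset_span (by simp))) h
  have hgJ := hJ (Ideal.mem_map_of_mem _ (Ideal.subset_span
    (show g ∈ ({f, g} : Set CoordRing) by simp)))
  -- Along the cone, `g = a f + b uⁿ` has order at least `n`: so does `f`, and `u` has order at
  -- least 1.
  obtain ⟨a, b, hab⟩ := Ideal.mem_span_pair.1 hgJ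
  have := congrArg (localConeHom hv hw) hab
  rw [map_add, map_mul, map_mul, map_pow, localConeHom_algebraMap, localConeHom_algebraMap,
    localConeHom_algebraMap] at this
  rw [← X_pow_dvd_coneHom_iff w hg, ← this]
  refine dvd_add (Dvd.dvd.mul_left ((X_pow_dvd_coneHom_iff w hf n).2 hfn) _)
    (Dvd.dvd.mul_left (pow_dvd_pow_of_dvd ?_ n) _)
  rw [PowerSeries.X_dvd_iff, constantCoeff_coneHom, FaithfulSMul.algebraMap_eq_zero_iff]
  rw [mem_pointIdeal_mk_iff] at hu
  simpa only [hw] using hu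

end

/-! ### Arcs on the Fermat cubic and its inflection points. -/

noncomputable section

/-- The Taylor polynomial of degree `5` of `(1 + a t) ^ (1 / 3)`. -/
def cubeRoot (a : ℂ) : Polynomial ℂ :=
  -- In the variable `u = a t / 9` the Taylor coefficients of `(1 + 9u)^(1/3)` are integers.
  let u := Polynomial.C (a / 9) * Polynomial.X
  1 + 3 * u - 9 * u ^ 2 + 45 * u ^ 3 - 270 * u ^ 4 + 1782 * u ^ 5

lemma cubeRoot_pow_three (a : ℂ) :
    Polynomial.X ^ 6 ∣ cubeRoot a ^ 3 - (1 + Polynomial.C a * Polynomial.X) := by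
  have h : Polynomial.C a * Polynomial.X = 9 * (Polynomial.C (a / 9) * Polynomial.X) := by
    rw [← mul_assoc, ← Polynomial.C_ofNat, ← Polynomial.C_mul]
    congr 2
    ring
  rw [cubeRoot, h]
  -- The cofactor collects the terms of degrees 6 to 15 in `u` of the cube of the truncation.
  refine Dvd.dvd.trans ?_ (Dvd.intro _ (?_ : (Polynomial.C (a / 9) * Polynomial.X) ^ 6 *
    (37422 - 48114 * (Polynomial.C (a / 9) * Polynomial.X) + 72171 * (Polynomial.C (a / 9) *
      Polynomial.X) ^ 2 + 392931 * (Polynomial.C (a / 9) * Polynomial.X) ^ 3 - 7072758 *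
      (Polynomial.C (a / 9) * Polynomial.X) ^ 4 + 75228426 * (Polynomial.C (a / 9) *
      Polynomial.X) ^ 5 - 235329948 * (Polynomial.C (a / 9) * Polynomial.X) ^ 6 + 818419140
      * (Polynomial.C (a / 9) * Polynomial.X) ^ 7 - 2572174440 * (Polynomial.C (a / 9) *
      Polynomial.X) ^ 8 + 5658783768 * (Polynomial.C (a / 9) * Polynomial.X) ^ 9) = _))
  · rw [mul_pow]
    exact dvd_mul_left _ _
  · ring

lemma eval_cubeRoot (a : ℂ) : (cubeRoot a).eval 0 = 1 := by
  simp [cubeRoot]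

lemma cubeRoot_eq_add (a : ℂ) : ∃ q : Polynomial ℂ, cubeRoot a =
    1 + Polynomial.C (a / 3) * Polynomial.X + Polynomial.C (-(a ^ 2 / 9)) * Polynomial.X ^ 2 +
      q * Polynomial.X ^ 3 := by
  have h1 : Polynomial.C (a / 3) = 3 * Polynomial.C (a / 9) := by
    rw [← Polynomial.C_ofNat, ← Polynomial.C_mul]
    congr 1
    ring
  have h2 : Polynomial.C (-(a ^ 2 / 9)) = - 9 * Polynomial.C (a / 9) ^ 2 := by
    rw [← Polynomial.C_ofNat, ← Polynomial.C_neg, ← Polynomial.C_pow, ← Polynomial.C_mul]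
    congr 1
    ring
  refine ⟨Polynomial.C (a / 9) ^ 3 * (45 - 270 * (Polynomial.C (a / 9) * Polynomial.X) +
    1782 * (Polynomial.C (a / 9) * Polynomial.X) ^ 2), ?_⟩
  rw [cubeRoot, h1, h2]
  ring

lemma coeff_one_cubeRoot (a : ℂ) : (cubeRoot a).coeff 1 = a / 3 := by
  obtain ⟨q, hq⟩ := cubeRoot_eq_add a
  rw [hq]
  simp [Polynomial.coeff_mul_X_pow', Polynomial.coeff_one]

lemma coeff_two_cubeRoot (a : ℂ) : (cubeRoot a).coeff 2 = -(a ^ 2 / 9) := by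
  obtain ⟨q, hq⟩ := cubeRoot_eq_add a
  rw [hq]
  simp [Polynomial.coeff_mul_X_pow', Polynomial.coeff_one]

lemma cubeRoot_zero : cubeRoot 0 = 1 := by
  simp [cubeRoot]

/-- The arc `t ↦ (vᵢ (1 + aᵢ t) ^ (1 / 3))`, truncated. -/
def arc (v a : Fin 3 → ℂ) (i : Fin 3) : Polynomial ℂ :=
  Polynomial.C (v i) * cubeRoot (a i)

lemma eval_arc (v a : Fin 3 → ℂ) (i : Fin 3) : (arc v a i).eval 0 = v i := by
  simp [arc, eval_cubeRoot]

lemma coeff_one_arc (v a : Fin 3 → ℂ) (i : Fin 3) : (arc v a i).coeff 1 = v i * (a i / 3) := by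
  simp [arc, coeff_one_cubeRoot]

lemma isHomogeneous_fermatCubic : fermatCubic.IsHomogeneous 3 :=
  ((MvPolynomial.isHomogeneous_X_pow _ _).add (MvPolynomial.isHomogeneous_X_pow _ _)).add
    (MvPolynomial.isHomogeneous_X_pow _ _)

lemma aeval_fermatCubic {A : Type*} [CommRing A] [Algebra ℂ A] (w : Fin 3 → A) :
    MvPolynomial.aeval w fermatCubic = w 0 ^ 3 + w 1 ^ 3 + w 2 ^ 3 := by
  simp [fermatCubic]

lemma eval_fermatCubic (w : Fin 3 → ℂ) :
    MvPolynomial.eval w fermatCubic = w 0 ^ 3 + w 1 ^ 3 + w 2 ^ 3 := by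
  simp [fermatCubic]

/-- Along the untruncated arc the cubic is `∑ vᵢ³ + t ∑ aᵢ vᵢ³`, which is zero by the two
hypotheses. Truncation changes each cube only from order 6 on. -/
lemma X_pow_dvd_aeval_arc_fermatCubic {v a : Fin 3 → ℂ}
    (hF : v 0 ^ 3 + v 1 ^ 3 + v 2 ^ 3 = 0)
    (ha : a 0 * v 0 ^ 3 + a 1 * v 1 ^ 3 + a 2 * v 2 ^ 3 = 0) :
    Polynomial.X ^ 6 ∣ MvPolynomial.aeval (arc v a) fermatCubic := by
  have h1 := congrArg Polynomial.C hF
  have h2 := congrArg Polynomial.C ha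
  simp only [map_add, map_mul, map_pow, map_zero] at h1 h2
  have : MvPolynomial.aeval (arc v a) fermatCubic =
      Polynomial.C (v 0) ^ 3 * (cubeRoot (a 0) ^ 3 - (1 + Polynomial.C (a 0) * Polynomial.X)) +
      Polynomial.C (v 1) ^ 3 * (cubeRoot (a 1) ^ 3 - (1 + Polynomial.C (a 1) * Polynomial.X)) +
      Polynomial.C (v 2) ^ 3 * (cubeRoot (a 2) ^ 3 - (1 + Polynomial.C (a 2) * Polynomial.X)) := by
    rw [aeval_fermatCubic]
    simp only [arc]
    linear_combination h1 + Polynomial.X * h2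
  rw [this]
  exact dvd_add (dvd_add ((cubeRoot_pow_three _).mul_left _) ((cubeRoot_pow_three _).mul_left _))
    ((cubeRoot_pow_three _).mul_left _)

/-- The ideal of a point off the line `x = 0` is generated by two linear forms. -/
lemma mem_span_of_mem_pointIdeal {v : Fin 3 → ℂ} (hv : v ≠ 0) (h0 : v 0 ≠ 0) {f : CoordRing}
    (hf : f ∈ pointIdeal (Projectivization.mk ℂ v hv)) :
    f ∈ Ideal.span {MvPolynomial.C (v 1) * MvPolynomial.X 0 - MvPolynomial.C (v 0) *
      MvPolynomial.X 1, MvPolynomial.C (v 2) * MvPolynomial.X 0 - MvPolynomial.C (v 0) *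
      MvPolynomial.X (2 : Fin 3)} := by
  set I : Ideal CoordRing := Ideal.span {MvPolynomial.C (v 1) * MvPolynomial.X 0 -
    MvPolynomial.C (v 0) * MvPolynomial.X 1, MvPolynomial.C (v 2) * MvPolynomial.X 0 -
    MvPolynomial.C (v 0) * MvPolynomial.X (2 : Fin 3)} with hI
  have hC : (MvPolynomial.C (v 0) * MvPolynomial.C (v 0)⁻¹ : CoordRing) = 1 := by
    rw [← MvPolynomial.C_mul, mul_inv_cancel₀ h0, MvPolynomial.C_1]
  -- Modulo the two linear forms, `Xᵢ = vᵢ (v₀⁻¹ X₀)`, so the quotient map factors through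
  -- restriction to the line of `v`.
  have h : (Polynomial.aeval (Ideal.Quotient.mkₐ ℂ I
        (MvPolynomial.C (v 0)⁻¹ * MvPolynomial.X 0))).comp
      (MvPolynomial.aeval (fun i => Polynomial.C (v i) * Polynomial.X : Fin 3 → Polynomial ℂ)) =
      Ideal.Quotient.mkₐ ℂ I := by
    ext i
    have hi : (Polynomial.aeval (Ideal.Quotient.mkₐ ℂ I
        (MvPolynomial.C (v 0)⁻¹ * MvPolynomial.X 0))) (Polynomial.C (v i) * Polynomial.X) =
        Ideal.Quotient.mkₐ ℂ I (MvPolynomial.C (v i) *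
          (MvPolynomial.C (v 0)⁻¹ * MvPolynomial.X 0)) := by
      rw [map_mul, map_mul, Polynomial.aeval_C, Polynomial.aeval_X]
      congr 1
    rw [AlgHom.comp_apply, MvPolynomial.aeval_X, hi]
    refine (Ideal.Quotient.mk_eq_mk_iff_sub_mem _ _).2 ?_
    fin_cases i
    · have : (MvPolynomial.C (v 0) * (MvPolynomial.C (v 0)⁻¹ * MvPolynomial.X 0) -
        MvPolynomial.X 0 : CoordRing) = 0 := by linear_combination MvPolynomial.X 0 * hC
      exact this ▸ I.zero_mem
    · have : (MvPolynomial.C (v 1) * (MvPolynomial.C (v 0)⁻¹ * MvPolynomial.X 0) -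
        MvPolynomial.X 1 : CoordRing) = MvPolynomial.C (v 0)⁻¹ *
          (MvPolynomial.C (v 1) * MvPolynomial.X 0 - MvPolynomial.C (v 0) * MvPolynomial.X 1) := by
        linear_combination MvPolynomial.X 1 * hC
      exact this ▸ I.mul_mem_left _ (Ideal.subset_span (by simp))
    · have : (MvPolynomial.C (v 2) * (MvPolynomial.C (v 0)⁻¹ * MvPolynomial.X 0) -
        MvPolynomial.X 2 : CoordRing) = MvPolynomial.C (v 0)⁻¹ *
          (MvPolynomial.C (v 2) * MvPolynomial.X 0 - MvPolynomial.C (v 0) * MvPolynomial.X 2) := by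
        linear_combination MvPolynomial.X 2 * hC
      exact this ▸ I.mul_mem_left _ (Ideal.subset_span (by simp))
  rw [mem_pointIdeal_mk_iff] at hf
  have := DFunLike.congr_fun h f
  rw [AlgHom.comp_apply, hf, map_zero] at this
  exact Ideal.Quotient.eq_zero_iff_mem.1 this.symm

/-- The relation puts `l * m` in `(f, u)`; once `m` becomes invertible, `l` itself is redundant as a
generator. -/
lemma map_mem_span_pair {R S : Type*} [CommRing R] [CommRing S] (φ : R →+* S) {f u l m a k : R}
    (h : l * m = a * f - k * u) (hm : IsUnit (φ m)) (b c : R) :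
    φ (b * u + c * l) ∈ Ideal.span {φ f, φ u} := by
  have hl : φ l ∈ Ideal.span {φ f, φ u} := by
    rw [← Ideal.mul_unit_mem_iff_mem _ hm, ← map_mul, h, map_sub, map_mul, map_mul]
    exact Ideal.sub_mem _ (Ideal.mul_mem_left _ _ (Ideal.subset_span (Set.mem_insert _ _)))
      (Ideal.mul_mem_left _ _ (Ideal.subset_span (Set.mem_insert_of_mem _ rfl)))
  rw [map_add, map_mul, map_mul]
  exact Ideal.add_mem _ (Ideal.mul_mem_left _ _ (Ideal.subset_span
    (Set.mem_insert_of_mem _ rfl))) (Ideal.mul_mem_left _ _ hl)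

/-- At a point of the Fermat cubic with `x z ≠ 0`, the maximal ideal of the local ring is
generated by the cubic and one linear form. -/
lemma algebraMap_mem_span_fermatCubic {v : Fin 3 → ℂ} (hv : v ≠ 0) (h0 : v 0 ≠ 0) (h2 : v 2 ≠ 0)
    (hF : v 0 ^ 3 + v 1 ^ 3 + v 2 ^ 3 = 0) {f : CoordRing}
    (hf : f ∈ pointIdeal (Projectivization.mk ℂ v hv)) :
    algebraMap CoordRing (Localization.AtPrime (pointIdeal (Projectivization.mk ℂ v hv))) f ∈
      Ideal.span {algebraMap CoordRing (Localization.AtPrime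
          (pointIdeal (Projectivization.mk ℂ v hv))) fermatCubic, algebraMap _ _
          (MvPolynomial.C (v 1) * MvPolynomial.X 0 - MvPolynomial.C (v 0) *
            MvPolynomial.X 1 : CoordRing)} := by
  set u : CoordRing := MvPolynomial.C (v 1) * MvPolynomial.X 0 - MvPolynomial.C (v 0) *
    MvPolynomial.X 1 with hu
  set l : CoordRing := MvPolynomial.C (v 2) * MvPolynomial.X 0 - MvPolynomial.C (v 0) *
    MvPolynomial.X 2 with hl
  set L := Localization.AtPrime (pointIdeal (Projectivization.mk ℂ v hv))
  -- Substituting `v₀X₁ = v₁X₀ - u` and `v₀X₂ = v₂X₀ - l` in `v₀³F` cancels the `X₀³` term and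
  -- leaves `k u + m l`. As `l` vanishes at `v`, only the first term of `m` survives there, and it
  -- is nonzero.
  set m : CoordRing := -3 * MvPolynomial.C (v 2) ^ 2 * MvPolynomial.X 0 ^ 2 +
    3 * MvPolynomial.C (v 2) * MvPolynomial.X 0 * l - l ^ 2 with hm
  set k : CoordRing := -3 * MvPolynomial.C (v 1) ^ 2 * MvPolynomial.X 0 ^ 2 +
    3 * MvPolynomial.C (v 1) * MvPolynomial.X 0 * u - u ^ 2 with hk
  have hFC : (MvPolynomial.C (v 0) ^ 3 + MvPolynomial.C (v 1) ^ 3 + MvPolynomial.C (v 2) ^ 3 :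
      CoordRing) = 0 := by
    simp only [← map_pow, ← map_add, hF, map_zero]
  have hrel : l * m = MvPolynomial.C (v 0) ^ 3 * fermatCubic - k * u := by
    rw [hm, hk, hl, hu, fermatCubic]
    linear_combination -MvPolynomial.X 0 ^ 3 * hFC
  have hmu : IsUnit (algebraMap CoordRing L m) := by
    refine IsLocalization.map_units L
      (⟨m, ?_⟩ : (pointIdeal (Projectivization.mk ℂ v hv)).primeCompl)
    rw [Ideal.mem_primeCompl_iff, mem_pointIdeal_mk_iff]
    have : MvPolynomial.aeval (fun i => Polynomial.C (v i) * Polynomial.X :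
        Fin 3 → Polynomial ℂ) m = Polynomial.C (-3 * v 2 ^ 2 * v 0 ^ 2) * Polynomial.X ^ 2 := by
      simp only [hm, hl, map_add, map_sub, map_mul, map_pow, map_neg, MvPolynomial.aeval_X,
        map_ofNat, ← MvPolynomial.algebraMap_eq, AlgHom.commutes, Polynomial.algebraMap_eq]
      ring
    rw [this]
    refine mul_ne_zero (Polynomial.C_ne_zero.2 ?_) (pow_ne_zero _ Polynomial.X_ne_zero)
    exact mul_ne_zero (mul_ne_zero (by norm_num) (pow_ne_zero _ h2)) (pow_ne_zero _ h0)
  obtain ⟨b, c, rfl⟩ := Ideal.mem_span_pair.1 (mem_span_of_mem_pointIdeal hv h0 hf)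
  refine map_mem_span_pair (algebraMap CoordRing L) hrel hmu b c

/-- Intersection multiplicities up to `6` with the Fermat cubic are vanishing orders along
truncated arcs. -/
theorem le_intersectionMultiplicity_fermatCubic_iff {v a : Fin 3 → ℂ} (hv : v ≠ 0)
    (hv' : ∀ i, v i ≠ 0) (hF : v 0 ^ 3 + v 1 ^ 3 + v 2 ^ 3 = 0)
    (ha : a 0 * v 0 ^ 3 + a 1 * v 1 ^ 3 + a 2 * v 2 ^ 3 = 0) (h01 : a 0 ≠ a 1)
    {g : CoordRing} {e : ℕ} (hg : g.IsHomogeneous e) {n : ℕ} (hn : n ≤ 6) :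
    (n : ℕ∞) ≤ intersectionMultiplicity fermatCubic g (Projectivization.mk ℂ v hv) ↔
      Polynomial.X ^ n ∣ MvPolynomial.aeval (arc v a) g := by
  have hfn : Polynomial.X ^ n ∣ MvPolynomial.aeval (arc v a) fermatCubic :=
    (pow_dvd_pow _ hn).trans (X_pow_dvd_aeval_arc_fermatCubic hF ha)
  constructor
  · refine dvd_of_le_intersectionMultiplicity hv (eval_arc v a) isHomogeneous_fermatCubic hg n hfn
      (u := MvPolynomial.C (v 1) * MvPolynomial.X 0 - MvPolynomial.C (v 0) * MvPolynomial.X 1) ?_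
      fun f hf => algebraMap_mem_span_fermatCubic hv (hv' 0) (hv' 2) hF hf
    rw [mem_pointIdeal_mk_iff]
    simp only [map_sub, map_mul, MvPolynomial.aeval_X, ← MvPolynomial.algebraMap_eq,
      AlgHom.commutes, Polynomial.algebraMap_eq]
    ring
  · intro hgn
    refine le_intersectionMultiplicity_of_dvd hv (eval_arc v a) 0 1 ?_ isHomogeneous_fermatCubic
      hg n hfn hgn
    rw [coeff_one_arc, coeff_one_arc]
    intro h
    apply h01
    have h3 : v 0 * v 1 * (a 0 - a 1) = 0 := by linear_combination 3 * h
    simpa [hv', sub_eq_zero] using h3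

lemma eval_pderiv_fermatCubic (v : Fin 3 → ℂ) (i : Fin 3) :
    MvPolynomial.eval v (MvPolynomial.pderiv i fermatCubic) = 3 * v i ^ 2 := by
  fin_cases i <;> simp [fermatCubic, MvPolynomial.pderiv_X, Derivation.leibniz_pow]

lemma isSmoothPoint_fermatCubic_iff (p : Plane) :
    IsSmoothPoint fermatCubic p ↔ p.rep 0 ^ 3 + p.rep 1 ^ 3 + p.rep 2 ^ 3 = 0 := by
  rw [IsSmoothPoint, eval_fermatCubic, and_iff_left_iff_imp]
  intro _
  obtain ⟨i, hi⟩ := Function.ne_iff.1 p.rep_nonzero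
  refine ⟨i, ?_⟩
  rw [eval_pderiv_fermatCubic]
  exact mul_ne_zero (by norm_num) (pow_ne_zero _ hi)

lemma isHomogeneous_tangentLine (f : CoordRing) (p : Plane) :
    (tangentLine f p).IsHomogeneous 1 :=
  MvPolynomial.IsHomogeneous.sum _ _ _ fun _ _ => MvPolynomial.isHomogeneous_C_mul_X _ _

lemma aeval_tangentLine_fermatCubic (p : Plane) (w : Fin 3 → Polynomial ℂ) :
    MvPolynomial.aeval w (tangentLine fermatCubic p) =
      ∑ i, Polynomial.C (3 * p.rep i ^ 2) * w i := by
  simp only [tangentLine, eval_pderiv_fermatCubic, map_sum, map_mul, MvPolynomial.aeval_X,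
    ← MvPolynomial.algebraMap_eq, AlgHom.commutes, Polynomial.algebraMap_eq]

/-- The arc `p + t eᵢ` runs along the tangent line, whose equation does not involve the `i`-th
coordinate; on it the cubic restricts to `t³`. -/
lemma isInflectionPoint_of_rep_eq_zero {p : Plane} (hp : IsSmoothPoint fermatCubic p) {i : Fin 3}
    (hi : p.rep i = 0) : IsInflectionPoint fermatCubic p := by
  refine ⟨hp, ?_⟩
  rw [isSmoothPoint_fermatCubic_iff] at hp
  obtain ⟨j, hj⟩ := Function.ne_iff.1 p.rep_nonzero
  have hij : i ≠ j := fun h => hj (h ▸ hi)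
  have hpC := congrArg Polynomial.C hp
  simp only [map_add, map_pow, map_zero] at hpC
  set w : Fin 3 → Polynomial ℂ := fun k =>
    Polynomial.C (p.rep k) + if k = i then Polynomial.X else 0 with hw
  have h := le_intersectionMultiplicity_of_dvd p.rep_nonzero (w := w) (fun k => ?_) i j ?_
    isHomogeneous_fermatCubic (isHomogeneous_tangentLine fermatCubic p) 3 ?_ ?_
  · rw [p.mk_rep] at h
    exact_mod_cast h
  · simp only [hw]
    split_ifs <;> simp
  · simp only [hw, hi, hij.symm]
    simpa [Polynomial.coeff_C] using hj
  · rw [aeval_fermatCubic]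
    refine ⟨1, ?_⟩
    fin_cases i <;> simp [hw] at hi ⊢ <;> simp [hi] at hpC ⊢ <;> linear_combination hpC
  · rw [aeval_tangentLine_fermatCubic]
    have : ∑ k, Polynomial.C (3 * p.rep k ^ 2) * w k = 0 := by
      rw [Fin.sum_univ_three]
      fin_cases i <;> simp [hw] at hi ⊢ <;> simp [hi] at hpC ⊢ <;>
        linear_combination Polynomial.C 3 * hpC
    rw [this]
    exact dvd_zero _

/-- With slopes `(0, p₂³, -p₁³)`, the `t²` coefficient of the tangent form along the arc is
`(p₀p₁p₂)³ / 3`, because `p₁³ + p₂³ = -p₀³`. -/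
lemma not_isInflectionPoint_of_rep_ne_zero {p : Plane} (hp : ∀ i, p.rep i ≠ 0) :
    ¬ IsInflectionPoint fermatCubic p := by
  rintro ⟨hs, hi⟩
  rw [isSmoothPoint_fermatCubic_iff] at hs
  rw [← p.mk_rep] at hi
  have h3 : ((3 : ℕ) : ℕ∞) ≤ intersectionMultiplicity fermatCubic
    (tangentLine fermatCubic p) (Projectivization.mk ℂ p.rep p.rep_nonzero) := by
    conv_rhs => rw [← p.mk_rep]
    simpa using hi
  rw [le_intersectionMultiplicity_fermatCubic_iff (a := ![0, p.rep 2 ^ 3, - p.rep 1 ^ 3])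
    p.rep_nonzero hp hs (by simp; ring) (by simpa using (pow_ne_zero 3 (hp 2)).symm)
    (isHomogeneous_tangentLine fermatCubic p) (by norm_num), Polynomial.X_pow_dvd_iff] at h3
  have h2 := h3 2 (by norm_num)
  rw [aeval_tangentLine_fermatCubic, Fin.sum_univ_three] at h2
  simp only [arc, Polynomial.coeff_add, Polynomial.coeff_C_mul, coeff_two_cubeRoot,
    Matrix.cons_val_zero, Matrix.cons_val_one, Matrix.cons_val] at h2
  have h : (p.rep 0 * p.rep 1 * p.rep 2) ^ 3 = 0 := by
    linear_combination 3 * h2 + p.rep 1 ^ 3 * p.rep 2 ^ 3 * hs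
  simp [hp] at h

lemma isHyperosculatingConic_fermatCubic_iff (Q : Conic) :
    IsHyperosculatingConic fermatCubic Q ↔ ∃ (v : Fin 3 → ℂ) (hv : v ≠ 0), (∀ i, v i ≠ 0) ∧
      v 0 ^ 3 + v 1 ^ 3 + v 2 ^ 3 = 0 ∧
      ((6 : ℕ) : ℕ∞) ≤ intersectionMultiplicity fermatCubic (Q.rep : CoordRing)
        (Projectivization.mk ℂ v hv) := by
  constructor
  · rintro ⟨p, hp, hi, h6⟩
    refine ⟨p.rep, p.rep_nonzero, fun i h => hi (isInflectionPoint_of_rep_eq_zero hp h),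
      (isSmoothPoint_fermatCubic_iff p).1 hp, ?_⟩
    rw [p.mk_rep]
    exact_mod_cast h6
  · rintro ⟨v, hv, hv', hF, h6⟩
    obtain ⟨a, ha⟩ := Projectivization.exists_smul_eq_mk_rep ℂ v hv
    refine ⟨_, ?_, not_isInflectionPoint_of_rep_ne_zero ?_, by exact_mod_cast h6⟩
    · rw [isSmoothPoint_fermatCubic_iff, ← ha]
      simp only [Pi.smul_apply, Units.smul_def, smul_eq_mul]
      linear_combination (a : ℂ) ^ 3 * hF
    · intro i
      rw [← ha]
      simpa [Units.smul_def] using hv' i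

end

/-! ### Conics with sixfold contact. -/

noncomputable section

lemma X_pow_six_dvd_iff (e₀ e₁ e₂ e₃ e₄ e₅ : ℂ) :
    (Polynomial.X ^ 6 ∣ Polynomial.C e₀ + Polynomial.C e₁ * Polynomial.X +
      Polynomial.C e₂ * Polynomial.X ^ 2 + Polynomial.C e₃ * Polynomial.X ^ 3 +
      Polynomial.C e₄ * Polynomial.X ^ 4 + Polynomial.C e₅ * Polynomial.X ^ 5) ↔
    e₀ = 0 ∧ e₁ = 0 ∧ e₂ = 0 ∧ e₃ = 0 ∧ e₄ = 0 ∧ e₅ = 0 := by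
  constructor
  · intro h
    rw [Polynomial.X_pow_dvd_iff] at h
    refine ⟨by simpa using h 0 (by norm_num), ?_, ?_, ?_, ?_, ?_⟩
    · simpa [Polynomial.coeff_C, Polynomial.coeff_X] using h 1 (by norm_num)
    · simpa [Polynomial.coeff_C, Polynomial.coeff_X] using h 2 (by norm_num)
    · simpa [Polynomial.coeff_C, Polynomial.coeff_X] using h 3 (by norm_num)
    · simpa [Polynomial.coeff_C, Polynomial.coeff_X] using h 4 (by norm_num)
    · simpa [Polynomial.coeff_C, Polynomial.coeff_X] using h 5 (by norm_num)
  · rintro ⟨rfl, rfl, rfl, rfl, rfl, rfl⟩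
    simp

/-- The Taylor coefficients of a ternary quadratic form along
`(1, (1 + 9bt)^(1/3), (1 + 9ct)^(1/3))`. -/
lemma X_pow_six_dvd_iff_taylor (A₀ A₁ A₂ A₃ A₄ A₅ b c : ℂ) :
    (Polynomial.X ^ 6 ∣ Polynomial.C A₀ + Polynomial.C A₁ * cubeRoot (9 * b) +
      Polynomial.C A₂ * cubeRoot (9 * c) + Polynomial.C A₃ * cubeRoot (9 * b) ^ 2 +
      Polynomial.C A₄ * (cubeRoot (9 * b) * cubeRoot (9 * c)) +
      Polynomial.C A₅ * cubeRoot (9 * c) ^ 2) ↔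
    A₀ + A₁ + A₂ + A₃ + A₄ + A₅ = 0 ∧
    A₁ * (3 * b) + A₂ * (3 * c) + A₃ * (6 * b) + A₄ * (3 * c + 3 * b) + A₅ * (6 * c) = 0 ∧
    A₁ * (-9 * b ^ 2) + A₂ * (-9 * c ^ 2) + A₃ * (-9 * b ^ 2) + A₄ * (-9 * c ^ 2 + 9 * b * c - 9
      * b ^ 2) + A₅ * (-9 * c ^ 2) = 0 ∧
    A₁ * (45 * b ^ 3) + A₂ * (45 * c ^ 3) + A₃ * (36 * b ^ 3) + A₄ * (45 * c ^ 3 - 27 * b * c ^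
      2 - 27 * b ^ 2 * c + 45 * b ^ 3) + A₅ * (36 * c ^ 3) = 0 ∧
    A₁ * (-270 * b ^ 4) + A₂ * (-270 * c ^ 4) + A₃ * (-189 * b ^ 4) + A₄ * (-270 * c ^ 4 + 135 *
      b * c ^ 3 + 81 * b ^ 2 * c ^ 2 + 135 * b ^ 3 * c - 270 * b ^ 4) + A₅ * (-189 * c ^ 4) = 0 ∧
    A₁ * (1782 * b ^ 5) + A₂ * (1782 * c ^ 5) + A₃ * (1134 * b ^ 5) + A₄ * (1782 * c ^ 5 - 810 *
      b * c ^ 4 - 405 * b ^ 2 * c ^ 3 - 405 * b ^ 3 * c ^ 2 - 810 * b ^ 4 * c + 1782 * b ^ 5) + A₅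
      * (1134 * c ^ 5) = 0 := by
  -- The explicit multiple of `X ^ 6` cancels the terms of degrees 6 to 10, leaving the Taylor
  -- polynomial of degree 5.
  rw [← X_pow_six_dvd_iff, ← dvd_add_left (dvd_mul_right (Polynomial.X ^ 6)
    (-(Polynomial.C A₃ * ((17577) * Polynomial.C b ^ 6 * Polynomial.X ^ 0 + (-56376) *
    Polynomial.C b ^ 7 * Polynomial.X ^ 1 + (233280) * Polynomial.C b ^ 8 * Polynomial.X ^ 2 +
    (-962280) * Polynomial.C b ^ 9 * Polynomial.X ^ 3 + (3175524) * Polynomial.C b ^ 10 *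
    Polynomial.X ^ 4) + Polynomial.C A₄ * ((5346) * Polynomial.C b ^ 1 * Polynomial.C c ^ 5 *
    Polynomial.X ^ 0 + (2430) * Polynomial.C b ^ 2 * Polynomial.C c ^ 4 * Polynomial.X ^ 0 +
    (2025) * Polynomial.C b ^ 3 * Polynomial.C c ^ 3 * Polynomial.X ^ 0 + (2430) * Polynomial.C b
    ^ 4 * Polynomial.C c ^ 2 * Polynomial.X ^ 0 + (5346) * Polynomial.C b ^ 5 * Polynomial.C c ^ 1
    * Polynomial.X ^ 0 + (-16038) * Polynomial.C b ^ 2 * Polynomial.C c ^ 5 * Polynomial.X ^ 1 +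
    (-12150) * Polynomial.C b ^ 3 * Polynomial.C c ^ 4 * Polynomial.X ^ 1 + (-12150) *
    Polynomial.C b ^ 4 * Polynomial.C c ^ 3 * Polynomial.X ^ 1 + (-16038) * Polynomial.C b ^ 5 *
    Polynomial.C c ^ 2 * Polynomial.X ^ 1 + (80190) * Polynomial.C b ^ 3 * Polynomial.C c ^ 5 *
    Polynomial.X ^ 2 + (72900) * Polynomial.C b ^ 4 * Polynomial.C c ^ 4 * Polynomial.X ^ 2 +
    (80190) * Polynomial.C b ^ 5 * Polynomial.C c ^ 3 * Polynomial.X ^ 2 + (-481140) *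
    Polynomial.C b ^ 4 * Polynomial.C c ^ 5 * Polynomial.X ^ 3 + (-481140) * Polynomial.C b ^ 5 *
    Polynomial.C c ^ 4 * Polynomial.X ^ 3 + (3175524) * Polynomial.C b ^ 5 * Polynomial.C c ^ 5 *
    Polynomial.X ^ 4) + Polynomial.C A₅ * ((17577) * Polynomial.C c ^ 6 * Polynomial.X ^ 0 +
    (-56376) * Polynomial.C c ^ 7 * Polynomial.X ^ 1 + (233280) * Polynomial.C c ^ 8 *
    Polynomial.X ^ 2 + (-962280) * Polynomial.C c ^ 9 * Polynomial.X ^ 3 + (3175524) *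
    Polynomial.C c ^ 10 * Polynomial.X ^ 4))))]
  refine iff_of_eq (congrArg _ ?_)
  rw [cubeRoot, cubeRoot, mul_div_cancel_left₀ b (by norm_num),
    mul_div_cancel_left₀ c (by norm_num)]
  simp only [map_add, map_sub, map_mul, map_pow, map_neg, map_ofNat]
  ring

/-- The six Taylor conditions form a square system whose determinant is a nonzero constant times the
product in `hD`. The multipliers of `k1` to `k5` come from inverting the system and clearing this
denominator. -/
lemma coeffs_eq_zero_of_dvd {A₀ A₁ A₂ A₃ A₄ A₅ b c : ℂ} (hb : b ≠ 0) (hc : c ≠ 0)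
    (hbc : b ≠ c) (h1 : b + c ≠ 0) (h2 : b - 2 * c ≠ 0) (h3 : c - 2 * b ≠ 0)
    (h : Polynomial.X ^ 6 ∣ Polynomial.C A₀ + Polynomial.C A₁ * cubeRoot (9 * b) +
      Polynomial.C A₂ * cubeRoot (9 * c) + Polynomial.C A₃ * cubeRoot (9 * b) ^ 2 +
      Polynomial.C A₄ * (cubeRoot (9 * b) * cubeRoot (9 * c)) +
      Polynomial.C A₅ * cubeRoot (9 * c) ^ 2) :
    A₀ = 0 ∧ A₁ = 0 ∧ A₂ = 0 ∧ A₃ = 0 ∧ A₄ = 0 ∧ A₅ = 0 := by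
  have hD : (b * c * (b - c)) ^ 4 * ((b + c) * (b - 2 * c) * (c - 2 * b)) ≠ 0 :=
    mul_ne_zero (pow_ne_zero _ (mul_ne_zero (mul_ne_zero hb hc) (sub_ne_zero.2 hbc)))
      (mul_ne_zero (mul_ne_zero h1 h2) h3)
  obtain ⟨h0, h1, h2, h3, h4, h5⟩ := (X_pow_six_dvd_iff_taylor _ _ _ _ _ _ _ _).1 h
  have k1 : (b * c * (b - c)) ^ 4 * ((b + c) * (b - 2 * c) * (c - 2 * b)) * A₁ = 0 := by
    linear_combination
      (2 / 3 * b ^ 3 * c ^ 11 - b ^ 4 * c ^ 10 - 5 * b ^ 5 * c ^ 9 + 19 * b ^ 6 * c ^ 8 - 27 * b ^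
      7 * c ^ 7 + 18 * b ^ 8 * c ^ 6 - 14 / 3 * b ^ 9 * c ^ 5) * h1 + (4 / 9 * b ^ 2 * c ^ 11 + 26
      / 9 * b ^ 3 * c ^ 10 - 134 / 9 * b ^ 4 * c ^ 9 + 224 / 9 * b ^ 5 * c ^ 8 - 104 / 9 * b ^ 6 *
      c ^ 7 - 166 / 9 * b ^ 7 * c ^ 6 + 26 * b ^ 8 * c ^ 5 - 28 / 3 * b ^ 9 * c ^ 4) * h2 + (8 / 9
      * b ^ 2 * c ^ 10 - 4 / 3 * b ^ 3 * c ^ 9 - 25 / 9 * b ^ 4 * c ^ 8 + 109 / 9 * b ^ 5 * c ^ 7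
      - 163 / 9 * b ^ 6 * c ^ 6 + 97 / 9 * b ^ 7 * c ^ 5 - 14 / 9 * b ^ 9 * c ^ 3) * h3 + (8 / 27
      * b ^ 2 * c ^ 9 - 26 / 27 * b ^ 3 * c ^ 8 + 38 / 27 * b ^ 4 * c ^ 7 - 20 / 27 * b ^ 5 * c ^
      6 - 28 / 27 * b ^ 6 * c ^ 5 + 46 / 27 * b ^ 7 * c ^ 4 - 2 / 3 * b ^ 8 * c ^ 3) * h4 + (2 /
      81 * b ^ 2 * c ^ 8 - 8 / 81 * b ^ 3 * c ^ 7 + 17 / 81 * b ^ 4 * c ^ 6 - 23 / 81 * b ^ 5 * c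
      ^ 5 + 17 / 81 * b ^ 6 * c ^ 4 - 5 / 81 * b ^ 7 * c ^ 3) * h5
  have k2 : (b * c * (b - c)) ^ 4 * ((b + c) * (b - 2 * c) * (c - 2 * b)) * A₂ = 0 := by
    linear_combination
      (-14 / 3 * b ^ 5 * c ^ 9 + 18 * b ^ 6 * c ^ 8 - 27 * b ^ 7 * c ^ 7 + 19 * b ^ 8 * c ^ 6 - 5
      * b ^ 9 * c ^ 5 - b ^ 10 * c ^ 4 + 2 / 3 * b ^ 11 * c ^ 3) * h1 + (-28 / 3 * b ^ 4 * c ^ 9 +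
      26 * b ^ 5 * c ^ 8 - 166 / 9 * b ^ 6 * c ^ 7 - 104 / 9 * b ^ 7 * c ^ 6 + 224 / 9 * b ^ 8 * c
      ^ 5 - 134 / 9 * b ^ 9 * c ^ 4 + 26 / 9 * b ^ 10 * c ^ 3 + 4 / 9 * b ^ 11 * c ^ 2) * h2 +
      (-14 / 9 * b ^ 3 * c ^ 9 + 97 / 9 * b ^ 5 * c ^ 7 - 163 / 9 * b ^ 6 * c ^ 6 + 109 / 9 * b ^
      7 * c ^ 5 - 25 / 9 * b ^ 8 * c ^ 4 - 4 / 3 * b ^ 9 * c ^ 3 + 8 / 9 * b ^ 10 * c ^ 2) * h3 +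
      (-2 / 3 * b ^ 3 * c ^ 8 + 46 / 27 * b ^ 4 * c ^ 7 - 28 / 27 * b ^ 5 * c ^ 6 - 20 / 27 * b ^
      6 * c ^ 5 + 38 / 27 * b ^ 7 * c ^ 4 - 26 / 27 * b ^ 8 * c ^ 3 + 8 / 27 * b ^ 9 * c ^ 2) * h4
      + (-5 / 81 * b ^ 3 * c ^ 7 + 17 / 81 * b ^ 4 * c ^ 6 - 23 / 81 * b ^ 5 * c ^ 5 + 17 / 81 * b
      ^ 6 * c ^ 4 - 8 / 81 * b ^ 7 * c ^ 3 + 2 / 81 * b ^ 8 * c ^ 2) * h5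
  have k3 : (b * c * (b - c)) ^ 4 * ((b + c) * (b - 2 * c) * (c - 2 * b)) * A₃ = 0 := by
    linear_combination
      (-2 / 3 * b ^ 3 * c ^ 11 + 7 / 3 * b ^ 4 * c ^ 10 - 20 / 3 * b ^ 5 * c ^ 9 + 37 / 3 * b ^ 6
      * c ^ 8 - 32 / 3 * b ^ 7 * c ^ 7 + 10 / 3 * b ^ 8 * c ^ 6) * h1 + (-2 / 9 * b ^ 2 * c ^ 11 -
      13 / 9 * b ^ 3 * c ^ 10 - 35 / 9 * b ^ 4 * c ^ 9 + 125 / 9 * b ^ 5 * c ^ 8 - 23 / 9 * b ^ 6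
      * c ^ 7 - 112 / 9 * b ^ 7 * c ^ 6 + 20 / 3 * b ^ 8 * c ^ 5) * h2 + (-4 / 9 * b ^ 2 * c ^ 10
      - 11 / 9 * b ^ 3 * c ^ 9 + 85 / 9 * b ^ 5 * c ^ 7 - 32 / 3 * b ^ 6 * c ^ 6 + 16 / 9 * b ^ 7
      * c ^ 5 + 10 / 9 * b ^ 8 * c ^ 4) * h3 + (-4 / 27 * b ^ 2 * c ^ 9 - 11 / 27 * b ^ 3 * c ^ 8
      + 35 / 27 * b ^ 4 * c ^ 7 - 5 / 27 * b ^ 5 * c ^ 6 - 31 / 27 * b ^ 6 * c ^ 5 + 16 / 27 * b ^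
      7 * c ^ 4) * h4 + (-1 / 81 * b ^ 2 * c ^ 8 - 1 / 27 * b ^ 3 * c ^ 7 + 14 / 81 * b ^ 4 * c ^
      6 - 5 / 27 * b ^ 5 * c ^ 5 + 5 / 81 * b ^ 6 * c ^ 4) * h5
  have k4 : (b * c * (b - c)) ^ 4 * ((b + c) * (b - 2 * c) * (c - 2 * b)) * A₄ = 0 := by
    linear_combination
      (14 / 3 * b ^ 5 * c ^ 9 - 18 * b ^ 6 * c ^ 8 + 80 / 3 * b ^ 7 * c ^ 7 - 18 * b ^ 8 * c ^ 6 +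
      14 / 3 * b ^ 9 * c ^ 5) * h1 + (28 / 3 * b ^ 4 * c ^ 9 - 26 * b ^ 5 * c ^ 8 + 50 / 3 * b ^ 6
      * c ^ 7 + 50 / 3 * b ^ 7 * c ^ 6 - 26 * b ^ 8 * c ^ 5 + 28 / 3 * b ^ 9 * c ^ 4) * h2 + (14 /
      9 * b ^ 3 * c ^ 9 - 104 / 9 * b ^ 5 * c ^ 7 + 20 * b ^ 6 * c ^ 6 - 104 / 9 * b ^ 7 * c ^ 5 +
      14 / 9 * b ^ 9 * c ^ 3) * h3 + (2 / 3 * b ^ 3 * c ^ 8 - 16 / 9 * b ^ 4 * c ^ 7 + 10 / 9 * b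
      ^ 5 * c ^ 6 + 10 / 9 * b ^ 6 * c ^ 5 - 16 / 9 * b ^ 7 * c ^ 4 + 2 / 3 * b ^ 8 * c ^ 3) * h4
      + (5 / 81 * b ^ 3 * c ^ 7 - 2 / 9 * b ^ 4 * c ^ 6 + 26 / 81 * b ^ 5 * c ^ 5 - 2 / 9 * b ^ 6
      * c ^ 4 + 5 / 81 * b ^ 7 * c ^ 3) * h5
  have k5 : (b * c * (b - c)) ^ 4 * ((b + c) * (b - 2 * c) * (c - 2 * b)) * A₅ = 0 := by
    linear_combination
      (10 / 3 * b ^ 6 * c ^ 8 - 32 / 3 * b ^ 7 * c ^ 7 + 37 / 3 * b ^ 8 * c ^ 6 - 20 / 3 * b ^ 9 *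
      c ^ 5 + 7 / 3 * b ^ 10 * c ^ 4 - 2 / 3 * b ^ 11 * c ^ 3) * h1 + (20 / 3 * b ^ 5 * c ^ 8 -
      112 / 9 * b ^ 6 * c ^ 7 - 23 / 9 * b ^ 7 * c ^ 6 + 125 / 9 * b ^ 8 * c ^ 5 - 35 / 9 * b ^ 9
      * c ^ 4 - 13 / 9 * b ^ 10 * c ^ 3 - 2 / 9 * b ^ 11 * c ^ 2) * h2 + (10 / 9 * b ^ 4 * c ^ 8 +
      16 / 9 * b ^ 5 * c ^ 7 - 32 / 3 * b ^ 6 * c ^ 6 + 85 / 9 * b ^ 7 * c ^ 5 - 11 / 9 * b ^ 9 *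
      c ^ 3 - 4 / 9 * b ^ 10 * c ^ 2) * h3 + (16 / 27 * b ^ 4 * c ^ 7 - 31 / 27 * b ^ 5 * c ^ 6 -
      5 / 27 * b ^ 6 * c ^ 5 + 35 / 27 * b ^ 7 * c ^ 4 - 11 / 27 * b ^ 8 * c ^ 3 - 4 / 27 * b ^ 9
      * c ^ 2) * h4 + (5 / 81 * b ^ 4 * c ^ 6 - 5 / 27 * b ^ 5 * c ^ 5 + 14 / 81 * b ^ 6 * c ^ 4 -
      1 / 27 * b ^ 7 * c ^ 3 - 1 / 81 * b ^ 8 * c ^ 2) * h5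
  have e1 := (mul_eq_zero_iff_left hD).1 k1
  have e2 := (mul_eq_zero_iff_left hD).1 k2
  have e3 := (mul_eq_zero_iff_left hD).1 k3
  have e4 := (mul_eq_zero_iff_left hD).1 k4
  have e5 := (mul_eq_zero_iff_left hD).1 k5
  refine ⟨?_, e1, e2, e3, e4, e5⟩
  linear_combination h0 - e1 - e2 - e3 - e4 - e5

/-- The degenerate case `c = -b` of the system: the conditions of orders 0 to 4 already cut the
solutions down to a line. -/
lemma coeffs_proportional_of_dvd {A₀ A₁ A₂ A₃ A₄ A₅ b : ℂ} (hb : b ≠ 0)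
    (h : Polynomial.X ^ 6 ∣ Polynomial.C A₀ + Polynomial.C A₁ * cubeRoot (9 * b) +
      Polynomial.C A₂ * cubeRoot (9 * -b) + Polynomial.C A₃ * cubeRoot (9 * b) ^ 2 +
      Polynomial.C A₄ * (cubeRoot (9 * b) * cubeRoot (9 * -b)) +
      Polynomial.C A₅ * cubeRoot (9 * -b) ^ 2) :
    A₀ = -4 * A₅ ∧ A₁ = 2 * A₅ ∧ A₂ = 2 * A₅ ∧ A₃ = A₅ ∧ A₄ = -2 * A₅ := by
  obtain ⟨h0, h1, h2, h3, h4, h5⟩ := (X_pow_six_dvd_iff_taylor _ _ _ _ _ _ _ _).1 h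
  replace h1 : A₁ * 3 + A₂ * -3 + A₃ * 6 + A₅ * -6 = 0 := by
    refine (mul_eq_zero_iff_left hb).1 ?_
    linear_combination h1
  replace h2 : A₁ * -9 + A₂ * -9 + A₃ * -9 + A₄ * -27 + A₅ * -9 = 0 := by
    refine (mul_eq_zero_iff_left (pow_ne_zero 2 hb)).1 ?_
    linear_combination h2
  replace h3 : A₁ * 45 + A₂ * -45 + A₃ * 36 + A₅ * -36 = 0 := by
    refine (mul_eq_zero_iff_left (pow_ne_zero 3 hb)).1 ?_
    linear_combination h3
  replace h4 : A₁ * -270 + A₂ * -270 + A₃ * -189 + A₄ * -729 + A₅ * -189 = 0 := by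
    refine (mul_eq_zero_iff_left (pow_ne_zero 4 hb)).1 ?_
    linear_combination h4
  have e3 : A₃ = A₅ := by linear_combination (15 * h1 - h3) / 54
  have e1 : A₁ = A₂ := by linear_combination h1 / 3 - 2 * e3
  have e4 : A₄ = -2 * A₅ := by linear_combination (30 * h2 - h4) / (-81) - e3
  have e2 : A₁ = 2 * A₅ := by linear_combination -h2 / 18 + e1 / 2 - e3 / 2 - 3 / 2 * e4
  refine ⟨?_, e2, e1 ▸ e2, e3, e4⟩
  linear_combination h0 + e1 - 2 * e2 - e3 - e4

/-- The ternary quadratic form with given coefficients of `x², xy, xz, y², yz, z²`. -/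
def ternaryForm (a : Fin 6 → ℂ) : CoordRing :=
  MvPolynomial.C (a 0) * MvPolynomial.X 0 ^ 2 +
  MvPolynomial.C (a 1) * (MvPolynomial.X 0 * MvPolynomial.X 1) +
  MvPolynomial.C (a 2) * (MvPolynomial.X 0 * MvPolynomial.X 2) +
  MvPolynomial.C (a 3) * MvPolynomial.X 1 ^ 2 +
  MvPolynomial.C (a 4) * (MvPolynomial.X 1 * MvPolynomial.X 2) +
  MvPolynomial.C (a 5) * MvPolynomial.X 2 ^ 2

lemma isHomogeneous_ternaryForm (a : Fin 6 → ℂ) : (ternaryForm a).IsHomogeneous 2 :=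
  have hX (i : Fin 3) := MvPolynomial.isHomogeneous_X ℂ i
  (((((MvPolynomial.isHomogeneous_C_mul_X_pow _ _ _).add (((hX 0).mul (hX 1)).C_mul _)).add
    (((hX 0).mul (hX 2)).C_mul _)).add (MvPolynomial.isHomogeneous_C_mul_X_pow _ _ _)).add
    (((hX 1).mul (hX 2)).C_mul _)).add (MvPolynomial.isHomogeneous_C_mul_X_pow _ _ _)

/-- Quadratic forms are sums of products of two linear forms. -/
lemma exists_eq_ternaryForm {f : CoordRing} (hf : f.IsHomogeneous 2) :
    ∃ a, f = ternaryForm a := by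
  have h : f ∈ MvPolynomial.homogeneousSubmodule (Fin 3) ℂ 1 *
      MvPolynomial.homogeneousSubmodule (Fin 3) ℂ 1 := by
    rw [← sq, MvPolynomial.homogeneousSubmodule_one_pow]
    exact hf
  have key : ∀ l ∈ MvPolynomial.homogeneousSubmodule (Fin 3) ℂ 1, ∃ c : Fin 3 → ℂ,
      l = MvPolynomial.C (c 0) * MvPolynomial.X 0 + MvPolynomial.C (c 1) * MvPolynomial.X 1 +
        MvPolynomial.C (c 2) * MvPolynomial.X 2 := by
    intro l hl
    rw [MvPolynomial.homogeneousSubmodule_one_eq_span_X, Submodule.mem_span_range_iff_exists_fun]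
      at hl
    obtain ⟨c, rfl⟩ := hl
    exact ⟨c, by simp [Fin.sum_univ_three, MvPolynomial.smul_eq_C_mul]⟩
  clear hf
  induction h using Submodule.mul_induction_on' with
  | mem_mul_mem l hl m hm =>
    obtain ⟨b, rfl⟩ := key l hl
    obtain ⟨c, rfl⟩ := key m hm
    refine ⟨![b 0 * c 0, b 0 * c 1 + b 1 * c 0, b 0 * c 2 + b 2 * c 0, b 1 * c 1,
      b 1 * c 2 + b 2 * c 1, b 2 * c 2], ?_⟩
    simp only [ternaryForm, Matrix.cons_val_zero, Matrix.cons_val_one, Matrix.cons_val,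
      map_add, map_mul]
    ring
  | add l _ m _ h1 h2 =>
    obtain ⟨a, rfl⟩ := h1
    obtain ⟨b, rfl⟩ := h2
    refine ⟨a + b, ?_⟩
    simp only [ternaryForm, Pi.add_apply, map_add]
    ring

lemma aeval_ternaryForm {A : Type*} [CommRing A] [Algebra ℂ A] (w : Fin 3 → A) (a : Fin 6 → ℂ) :
    MvPolynomial.aeval w (ternaryForm a) = algebraMap ℂ A (a 0) * w 0 ^ 2 +
      algebraMap ℂ A (a 1) * (w 0 * w 1) + algebraMap ℂ A (a 2) * (w 0 * w 2) +
      algebraMap ℂ A (a 3) * w 1 ^ 2 + algebraMap ℂ A (a 4) * (w 1 * w 2) +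
      algebraMap ℂ A (a 5) * w 2 ^ 2 := by
  simp only [ternaryForm, map_add, map_mul, map_pow, MvPolynomial.aeval_X,
    ← MvPolynomial.algebraMap_eq, AlgHom.commutes]

lemma ternaryForm_injective : Function.Injective ternaryForm := by
  intro a b h
  have key : ∀ w : Fin 3 → ℂ, _ := fun w => congrArg (MvPolynomial.aeval w) h
  simp only [aeval_ternaryForm, Algebra.algebraMap_self, RingHom.id_apply] at key
  have e0 := key ![1, 0, 0]
  have e3 := key ![0, 1, 0]
  have e5 := key ![0, 0, 1]
  have e1 := key ![1, 1, 0]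
  have e2 := key ![1, 0, 1]
  have e4 := key ![0, 1, 1]
  simp at e0 e1 e2 e3 e4 e5
  ext i
  fin_cases i
  · exact e0
  · change a 1 = b 1
    linear_combination e1 - e0 - e3
  · change a 2 = b 2
    linear_combination e2 - e0 - e5
  · exact e3
  · change a 4 = b 4
    linear_combination e4 - e3 - e5
  · exact e5

lemma aeval_arc_ternaryForm (v : Fin 3 → ℂ) (b c : ℂ) (a : Fin 6 → ℂ) :
    MvPolynomial.aeval (arc v ![0, 9 * b, 9 * c]) (ternaryForm a) =
      Polynomial.C (a 0 * v 0 ^ 2) + Polynomial.C (a 1 * v 0 * v 1) * cubeRoot (9 * b) +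
      Polynomial.C (a 2 * v 0 * v 2) * cubeRoot (9 * c) +
      Polynomial.C (a 3 * v 1 ^ 2) * cubeRoot (9 * b) ^ 2 +
      Polynomial.C (a 4 * v 1 * v 2) * (cubeRoot (9 * b) * cubeRoot (9 * c)) +
      Polynomial.C (a 5 * v 2 ^ 2) * cubeRoot (9 * c) ^ 2 := by
  rw [aeval_ternaryForm]
  simp only [arc, Matrix.cons_val_zero, Matrix.cons_val_one, Matrix.cons_val, cubeRoot_zero,
    Polynomial.algebraMap_eq, map_mul, map_pow]
  ring

/-- If a conic meets the Fermat cubic with multiplicity at least `6` at a point off the coordinate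
axes, then two coordinates of the point have the same cube. -/
lemma exists_pow_three_eq_of_six_le {v : Fin 3 → ℂ} (hv : v ≠ 0) (hv' : ∀ i, v i ≠ 0)
    (hF : v 0 ^ 3 + v 1 ^ 3 + v 2 ^ 3 = 0) {g : CoordRing} (hg : g.IsHomogeneous 2) (hg0 : g ≠ 0)
    (h : ((6 : ℕ) : ℕ∞) ≤ intersectionMultiplicity fermatCubic g (Projectivization.mk ℂ v hv)) :
    ∃ i, v (i + 1) ^ 3 = v (i + 2) ^ 3 := by
  by_contra! hne
  have n0 : v 1 ^ 3 ≠ v 2 ^ 3 := hne 0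
  have n1 : v 2 ^ 3 ≠ v 0 ^ 3 := hne 1
  have n2 : v 0 ^ 3 ≠ v 1 ^ 3 := hne 2
  obtain ⟨a, rfl⟩ := exists_eq_ternaryForm hg
  rw [le_intersectionMultiplicity_fermatCubic_iff (a := ![0, 9 * v 2 ^ 3, 9 * -v 1 ^ 3]) hv hv' hF
    (by simp; ring) (by simpa using hv' 2) hg le_rfl,
    aeval_arc_ternaryForm] at h
  -- For `b = v₂³` and `c = -v₁³` the cubic equation gives `b - c = -v₀³`, while `b + c`, `b - 2c`
  -- and `c - 2b` become `v₂³ - v₁³`, `v₁³ - v₀³` and `v₀³ - v₂³`.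
  obtain ⟨e0, e1, e2, e3, e4, e5⟩ := coeffs_eq_zero_of_dvd (pow_ne_zero 3 (hv' 2))
    (neg_ne_zero.2 (pow_ne_zero 3 (hv' 1)))
    (fun h => pow_ne_zero 3 (hv' 0) (by linear_combination hF - h))
    (fun h => n0 (by linear_combination -h)) (fun h => n2 (by linear_combination hF - h))
    (fun h => n1 (by linear_combination -h - hF)) h
  simp [hv'] at e0 e1 e2 e3 e4 e5
  apply hg0
  simp [ternaryForm, e0, e1, e2, e3, e4, e5]

/-- The coefficients of the hyperosculating conic at `(c : 1 : 1)`. -/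
def sexticCoeffs (c : ℂ) : Fin 6 → ℂ := ![-4 / c ^ 2, 2 / c, 2 / c, 1, -2, 1]

/-- The hyperosculating conic at `(c : 1 : 1)` is unique. -/
lemma six_le_iff {c : ℂ} (hc : c ^ 3 = -2) (hv : ![c, 1, 1] ≠ 0) {g : CoordRing}
    (hg : g.IsHomogeneous 2) :
    ((6 : ℕ) : ℕ∞) ≤ intersectionMultiplicity fermatCubic g
        (Projectivization.mk ℂ ![c, 1, 1] hv) ↔
      ∃ k : ℂ, g = k • ternaryForm (sexticCoeffs c) := by
  have hc0 : c ≠ 0 := by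
    rintro rfl
    norm_num at hc
  have hv' : ∀ i, (![c, 1, 1] : Fin 3 → ℂ) i ≠ 0 := by
    intro i
    fin_cases i <;> simp [hc0]
  rw [le_intersectionMultiplicity_fermatCubic_iff (a := ![0, 9 * 1, 9 * -1]) hv hv'
    (by simp [hc]; norm_num) (by simp) (by simp) hg le_rfl]
  constructor
  · obtain ⟨a, rfl⟩ := exists_eq_ternaryForm hg
    rw [aeval_arc_ternaryForm]
    intro h
    obtain ⟨e0, e1, e2, e3, e4⟩ := coeffs_proportional_of_dvd one_ne_zero h
    simp at e0 e1 e2 e3 e4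
    refine ⟨a 5, ?_⟩
    have h0 : a 0 = a 5 * (-4 / c ^ 2) := by field_simp; linear_combination e0
    have h1 : a 1 = a 5 * (2 / c) := by field_simp; linear_combination e1
    have h2 : a 2 = a 5 * (2 / c) := by field_simp; linear_combination e2
    simp only [ternaryForm, sexticCoeffs, MvPolynomial.smul_eq_C_mul, h0, h1, h2, e3, e4,
      Matrix.cons_val_zero, Matrix.cons_val_one, Matrix.cons_val, map_mul, map_neg, map_one]
    ring
  · rintro ⟨k, rfl⟩
    rw [map_smul, aeval_arc_ternaryForm]
    refine Dvd.dvd.trans ?_ (Dvd.intro_left (Polynomial.C k) (by rw [Polynomial.smul_eq_C_mul]))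
    rw [X_pow_six_dvd_iff_taylor]
    simp [sexticCoeffs, hc0]
    norm_num

end

/-! ### Free orbits and their unordered pairs. -/

section OrbitCounting

variable {Γ α : Type*} [Group Γ] [MulAction Γ α] {S : Subgroup Γ} {x : α}

lemma eq_one_of_smul_eq_of_mem_orbit (hx : ∀ t ∈ S, t • x = x → t = 1) {t : Γ} (ht : t ∈ S)
    {y : α} (hy : y ∈ MulAction.orbit S x) (h : t • y = y) : t = 1 := by
  obtain ⟨⟨s, hs⟩, rfl⟩ := hy
  change t • s • x = s • x at h
  have h1 : (s⁻¹ * t * s) • x = x := by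
    rw [mul_smul, mul_smul, h, inv_smul_smul]
  have h2 := hx _ (S.mul_mem (S.mul_mem (S.inv_mem hs) ht) hs) h1
  have h3 : t = s * (s⁻¹ * t * s) * s⁻¹ := by group
  rw [h3, h2]
  group

lemma ncard_orbit_of_free (hx : ∀ t ∈ S, t • x = x → t = 1) :
    (MulAction.orbit S x).ncard = Nat.card S := by
  rw [MulAction.orbit, ← Set.image_univ, Set.ncard_image_of_injective, Set.ncard_univ]
  rintro ⟨s, hs⟩ ⟨t, ht⟩ hst
  change s • x = t • x at hst
  have := hx (t⁻¹ * s) (S.mul_mem (S.inv_mem ht) hs) (by rw [mul_smul, hst, inv_smul_smul])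
  rw [Subtype.mk.injEq]
  exact (inv_mul_eq_one.1 this).symm

lemma smul_orbit_of_mem {t : Γ} (ht : t ∈ S) : t • MulAction.orbit S x = MulAction.orbit S x :=
  MulAction.smul_orbit (⟨t, ht⟩ : S) x

/-- An element preserving a pair fixes both points or swaps them. In the second case its square
fixes a point, so `t² = 1`, and odd order forces `t = 1`. -/
lemma eq_one_of_smul_pair_eq (hodd : Odd (Nat.card S)) (hx : ∀ t ∈ S, t • x = x → t = 1)
    {t : Γ} (ht : t ∈ S) {P : Set α} (hP : P ∈ unorderedPairs (MulAction.orbit S x))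
    (h : t • P = P) : t = 1 := by
  obtain ⟨hPs, hP2⟩ := hP
  obtain ⟨a, b, hab, rfl⟩ := Set.ncard_eq_two.1 hP2
  have ha : t • a ∈ ({a, b} : Set α) := h ▸ Set.smul_mem_smul_set (by simp)
  have hb : t • b ∈ ({a, b} : Set α) := h ▸ Set.smul_mem_smul_set (by simp)
  have haO := hPs (show a ∈ ({a, b} : Set α) by simp)
  rcases ha with ha | ha
  · exact eq_one_of_smul_eq_of_mem_orbit hx ht haO ha
  · have ha' : t • a = b := ha
    have hb' : t • b = a := by
      rcases hb with hb | hb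
      · exact hb
      · exact absurd (MulAction.injective t (ha'.trans (Set.mem_singleton_iff.1 hb).symm)) hab
    have h2 : t ^ 2 = 1 := eq_one_of_smul_eq_of_mem_orbit hx (S.pow_mem ht 2) haO
      (by rw [sq, mul_smul, ha', hb'])
    have hn : t ^ Nat.card S = 1 := by
      have := pow_card_eq_one' (x := (⟨t, ht⟩ : S))
      exact congrArg Subtype.val this
    have h1 : orderOf t ∣ Nat.gcd 2 (Nat.card S) :=
      Nat.dvd_gcd (orderOf_dvd_of_pow_eq_one h2) (orderOf_dvd_of_pow_eq_one hn)
    rw [Nat.coprime_two_left.2 hodd] at h1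
    exact orderOf_eq_one_iff.1 (Nat.dvd_one.1 h1)

lemma smul_mem_unorderedPairs {t : Γ} (ht : t ∈ S) {P : Set α}
    (hP : P ∈ unorderedPairs (MulAction.orbit S x)) :
    t • P ∈ unorderedPairs (MulAction.orbit S x) := by
  refine ⟨?_, by rw [Set.ncard_smul_set, hP.2]⟩
  rw [← smul_orbit_of_mem (x := x) ht]
  exact Set.smul_set_mono hP.1

lemma ncard_unorderedPairs {β : Type*} {H : Set β} (hH : H.Finite) :
    (unorderedPairs H).Finite ∧ (unorderedPairs H).ncard = H.ncard.choose 2 := by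
  lift H to Finset β using hH
  have h : unorderedPairs (H : Set β) =
      (fun s : Finset β => (s : Set β)) '' (H.powersetCard 2 : Set (Finset β)) := by
    ext P
    simp only [unorderedPairs, Set.mem_ofPred_eq, Set.mem_image, Finset.mem_coe,
      Finset.mem_powersetCard]
    constructor
    · rintro ⟨h1, h2⟩
      lift P to Finset β using H.finite_toSet.subset h1
      exact ⟨P, ⟨by exact_mod_cast h1, by simpa using h2⟩, rfl⟩
    · rintro ⟨s, ⟨h1, h2⟩, rfl⟩
      exact ⟨by exact_mod_cast h1, by simpa using h2⟩
  rw [h]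
  refine ⟨(Finset.finite_toSet _).image _, ?_⟩
  rw [Set.ncard_image_of_injective _ Finset.coe_injective, Set.ncard_coe_finset,
    Set.ncard_coe_finset, Finset.card_powersetCard]

/-- The number of orbits on an invariant finite set on which the group acts freely. -/
lemma ncard_image_orbit_mul {U : Set α} (hU : U.Finite) (hinv : ∀ t ∈ S, ∀ P ∈ U, t • P ∈ U)
    (hfree : ∀ t ∈ S, ∀ P ∈ U, t • P = P → t = 1) :
    (MulAction.orbit S '' U).ncard * Nat.card S = U.ncard := by
  classical
  lift U to Finset α using hU
  rw [← Finset.coe_image, Set.ncard_coe_finset, Set.ncard_coe_finset,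
    Finset.card_eq_sum_card_image (MulAction.orbit S) U]
  refine (Finset.sum_const_nat ?_).symm
  intro O hO
  obtain ⟨P, hP, rfl⟩ := Finset.mem_image.1 hO
  rw [← ncard_orbit_of_free (fun t ht => hfree t ht P hP), ← Set.ncard_coe_finset]
  congr 1
  ext Q
  simp only [Finset.coe_filter, Set.mem_ofPred_eq, MulAction.orbit_eq_iff]
  refine ⟨fun h => h.2, fun h => ⟨?_, h⟩⟩
  obtain ⟨⟨s, hs⟩, rfl⟩ := h
  exact hinv s hs P hP

lemma ncard_image_orbit_unorderedPairs (hodd : Odd (Nat.card S)) (hx : ∀ t ∈ S, t • x = x → t = 1)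
    (hfin : Finite S) :
    (MulAction.orbit S '' unorderedPairs (MulAction.orbit S x)).ncard * Nat.card S =
      (Nat.card S).choose 2 := by
  have hO : (MulAction.orbit S x).Finite := Set.finite_range _
  obtain ⟨h1, h2⟩ := ncard_unorderedPairs hO
  rw [ncard_orbit_of_free hx] at h2
  rw [← h2]
  exact ncard_image_orbit_mul h1 (fun t ht P hP => smul_mem_unorderedPairs ht hP)
    fun t ht P hP h => eq_one_of_smul_pair_eq hodd hx ht hP h

end OrbitCounting

/-! ### The monomial group and its action on hyperosculating conics. -/

noncomputable section

/-- The matrix of `v ↦ (dᵢ v_{i + k})ᵢ`. -/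
def monomialMatrix (d : Fin 3 → ℂ) (k : Fin 3) : Matrix (Fin 3) (Fin 3) ℂ :=
  Matrix.of fun i j => if j = i + k then d i else 0

lemma monomialMatrix_mul (d e : Fin 3 → ℂ) (k l : Fin 3) :
    monomialMatrix d k * monomialMatrix e l =
      monomialMatrix (fun i => d i * e (i + k)) (k + l) := by
  ext i j
  rw [Matrix.mul_apply, Finset.sum_eq_single (i + k)]
  · simp [monomialMatrix, add_assoc]
  · intro b _ hb
    simp [monomialMatrix, hb]
  · simp

lemma monomialMatrix_one_zero : monomialMatrix 1 0 = 1 := by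
  ext i j
  simp [monomialMatrix, Matrix.one_apply, eq_comm]

/-- The invertible matrix of `v ↦ (dᵢ v_{i + k})ᵢ`. -/
def monomialGL (d : Fin 3 → ℂˣ) (k : Fin 3) : GL (Fin 3) ℂ where
  val := monomialMatrix (fun i => d i) k
  inv := monomialMatrix (fun i => ((d (i - k))⁻¹ : ℂˣ)) (-k)
  val_inv := by
    rw [monomialMatrix_mul, add_neg_cancel, ← monomialMatrix_one_zero]
    congr 1
    ext i
    simp
  inv_val := by
    rw [monomialMatrix_mul, neg_add_cancel, ← monomialMatrix_one_zero]
    congr 1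
    ext i
    simp [sub_eq_add_neg]

lemma monomialGL_mul (d e : Fin 3 → ℂˣ) (k l : Fin 3) :
    monomialGL d k * monomialGL e l = monomialGL (fun i => d i * e (i + k)) (k + l) :=
  Units.ext <| (monomialMatrix_mul _ _ _ _).trans (by simp [monomialGL])

lemma monomialGL_one_zero : monomialGL 1 0 = 1 :=
  Units.ext monomialMatrix_one_zero

lemma monomialGL_inv (d : Fin 3 → ℂˣ) (k : Fin 3) :
    (monomialGL d k)⁻¹ = monomialGL (fun i => (d (i - k))⁻¹) (-k) := by
  rw [inv_eq_iff_mul_eq_one, monomialGL_mul, add_neg_cancel, ← monomialGL_one_zero]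
  congr 1
  ext i
  simp

lemma monomialGL_const (u : ℂˣ) :
    monomialGL (fun _ => u) 0 = Matrix.GeneralLinearGroup.scalar (Fin 3) u := by
  ext i j
  simp [monomialGL, monomialMatrix, Matrix.scalar_apply, Matrix.diagonal_apply, eq_comm]

lemma mk_monomialGL_eq_iff {d e : Fin 3 → ℂˣ} {k l : Fin 3} :
    Matrix.ProjGenLinGroup.mk (monomialGL d k) = Matrix.ProjGenLinGroup.mk (monomialGL e l) ↔
      k = l ∧ ∃ u : ℂˣ, ∀ i, d i * u = e i := by
  rw [Matrix.ProjGenLinGroup.mk_eq_mk_iff]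
  constructor
  · rintro ⟨u, hu⟩
    rw [← monomialGL_const, monomialGL_mul, add_zero] at hu
    have hentry : ∀ i, (d i * u : ℂ) = if i + k = i + l then (e i : ℂ) else 0 := by
      intro i
      have := congrArg (fun g : GL (Fin 3) ℂ => (g : Matrix (Fin 3) (Fin 3) ℂ) i (i + k)) hu
      simpa [monomialGL, monomialMatrix] using this
    have hkl : k = l := by
      by_contra h
      have := hentry 0
      simp [h] at this
    refine ⟨hkl, u, fun i => Units.ext ?_⟩
    simpa [hkl] using hentry i
  · rintro ⟨rfl, u, hu⟩
    refine ⟨u, ?_⟩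
    rw [← monomialGL_const, monomialGL_mul, add_zero]
    congr 1
    exact funext hu

lemma aeval_substMatrix_monomialMatrix {A : Type*} [CommRing A] [Algebra ℂ A] (w : Fin 3 → A)
    (d : Fin 3 → ℂ) (k : Fin 3) (f : CoordRing) :
    MvPolynomial.aeval w (substMatrix (monomialMatrix d k) f) =
      MvPolynomial.aeval (fun i => algebraMap ℂ A (d i) * w (i + k)) f := by
  have h : (MvPolynomial.aeval w).comp (substMatrix (monomialMatrix d k)) =
      MvPolynomial.aeval (fun i => algebraMap ℂ A (d i) * w (i + k)) := by
    ext i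
    rw [AlgHom.comp_apply, substMatrix_X, MvPolynomial.aeval_X, Finset.sum_eq_single (i + k)]
    · rw [map_mul, MvPolynomial.aeval_X, ← MvPolynomial.algebraMap_eq, AlgHom.commutes]
      simp [monomialMatrix]
    · intro b _ hb
      simp [monomialMatrix, hb]
    · simp
  exact DFunLike.congr_fun h f

/-- The curve `g = 0` meets the Fermat cubic with multiplicity at least `6` at the point `v`,
which does not lie on the coordinate axes. -/
def HyperosculatesAt (g : CoordRing) (v : Fin 3 → ℂ) : Prop :=
  ∃ hv : v ≠ 0, (∀ i, v i ≠ 0) ∧ v 0 ^ 3 + v 1 ^ 3 + v 2 ^ 3 = 0 ∧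
    ((6 : ℕ) : ℕ∞) ≤ intersectionMultiplicity fermatCubic g (Projectivization.mk ℂ v hv)

/-- Slopes of the arc at `v` that are permuted along with the coordinates. -/
def cyclicSlopes (v : Fin 3 → ℂ) (i : Fin 3) : ℂ := v (i + 1) ^ 3 - v (i + 2) ^ 3

/-- The cyclic slopes always satisfy `∑ aᵢ vᵢ³ = 0`, and on the cubic `a₀ - a₁ = -3v₂³ ≠ 0`, so they
define an admissible arc at every point off the axes. -/
lemma hyperosculatesAt_iff {g : CoordRing} {e : ℕ} (hg : g.IsHomogeneous e) (v : Fin 3 → ℂ) :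
    HyperosculatesAt g v ↔ (∀ i, v i ≠ 0) ∧ v 0 ^ 3 + v 1 ^ 3 + v 2 ^ 3 = 0 ∧
      Polynomial.X ^ 6 ∣ MvPolynomial.aeval (arc v (cyclicSlopes v)) g := by
  have key : ∀ hv : v ≠ 0, (∀ i, v i ≠ 0) → v 0 ^ 3 + v 1 ^ 3 + v 2 ^ 3 = 0 →
      (((6 : ℕ) : ℕ∞) ≤ intersectionMultiplicity fermatCubic g (Projectivization.mk ℂ v hv) ↔
        Polynomial.X ^ 6 ∣ MvPolynomial.aeval (arc v (cyclicSlopes v)) g) := by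
    intro hv hv' hF
    have s0 : cyclicSlopes v 0 = v 1 ^ 3 - v 2 ^ 3 := rfl
    have s1 : cyclicSlopes v 1 = v 2 ^ 3 - v 0 ^ 3 := rfl
    have s2 : cyclicSlopes v 2 = v 0 ^ 3 - v 1 ^ 3 := rfl
    refine le_intersectionMultiplicity_fermatCubic_iff hv hv' hF ?_ ?_ hg le_rfl
    · rw [s0, s1, s2]
      ring
    · rw [s0, s1]
      intro h
      exact pow_ne_zero 3 (hv' 2) (by linear_combination (hF - h) / 3)
  constructor
  · rintro ⟨hv, h1, h2, h3⟩
    exact ⟨h1, h2, (key hv h1 h2).1 h3⟩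
  · rintro ⟨h1, h2, h3⟩
    have hv : v ≠ 0 := fun h => h1 0 (congrFun h 0)
    exact ⟨hv, h1, h2, (key hv h1 h2).2 h3⟩

lemma HyperosculatesAt.const_smul {g : CoordRing} {v : Fin 3 → ℂ} (h : HyperosculatesAt g v)
    {a : ℂ} (ha : a ≠ 0) : HyperosculatesAt g (a • v) := by
  obtain ⟨hv, h1, h2, h3⟩ := h
  refine ⟨smul_ne_zero ha hv, fun i => mul_ne_zero ha (h1 i), ?_, ?_⟩
  · simp only [Pi.smul_apply, smul_eq_mul]
    linear_combination a ^ 3 * h2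
  · rwa [(Projectivization.mk_eq_mk_iff' ℂ (a • v) v _ hv).2 ⟨a, rfl⟩]

/-- The slopes depend only on the cubes of the coordinates and rotate with them. Hence the arc at
the image point is the image of the arc at `v`, and pulling the form back recovers the original
restriction. -/
lemma HyperosculatesAt.monomialGL_smul {q : QuadForm} {v : Fin 3 → ℂ}
    (h : HyperosculatesAt (q : CoordRing) v) {d : Fin 3 → ℂˣ} (hd : ∀ i, d i ^ 3 = 1)
    (k : Fin 3) :
    HyperosculatesAt ((monomialGL d k • q : QuadForm) : CoordRing) (fun i => d i * v (i + k)) := by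
  rw [hyperosculatesAt_iff q.2] at h
  rw [hyperosculatesAt_iff (monomialGL d k • q : QuadForm).2]
  obtain ⟨h1, h2, h3⟩ := h
  have hd' : ∀ i, (d i : ℂ) ^ 3 = 1 := fun i => by
    rw [← Units.val_pow_eq_pow_val, hd i, Units.val_one]
  refine ⟨fun i => mul_ne_zero (d i).ne_zero (h1 _), ?_, ?_⟩
  · simp only [mul_pow, hd', one_mul]
    fin_cases k
    · exact h2
    · change v 1 ^ 3 + v 2 ^ 3 + v 0 ^ 3 = 0
      linear_combination h2
    · change v 2 ^ 3 + v 0 ^ 3 + v 1 ^ 3 = 0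
      linear_combination h2
  · rw [coe_smul_quadForm, monomialGL_inv, monomialGL]
    change _ ∣ MvPolynomial.aeval _ (substMatrix (monomialMatrix _ _) _)
    rw [aeval_substMatrix_monomialMatrix]
    refine (iff_of_eq (congrArg (fun w => Polynomial.X ^ 6 ∣
      MvPolynomial.aeval w (q : CoordRing)) ?_)).2 h3
    ext1 i
    have hc : ∀ j, cyclicSlopes (fun i => d i * v (i + k)) j = cyclicSlopes v (j + k) := by
      intro j
      simp only [cyclicSlopes, mul_pow, hd', one_mul]
      rw [add_right_comm, add_right_comm j 2]
    simp only [arc, hc, Polynomial.algebraMap_eq, ← sub_eq_add_neg, sub_add_cancel]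
    rw [← mul_assoc, ← Polynomial.C_mul, ← mul_assoc, Units.inv_mul, one_mul]

lemma isHyperosculatingConic_mk_iff {q : QuadForm} (hq : q ≠ 0) :
    IsHyperosculatingConic fermatCubic (Projectivization.mk ℂ q hq) ↔
      ∃ v, HyperosculatesAt (q : CoordRing) v := by
  rw [isHyperosculatingConic_fermatCubic_iff]
  obtain ⟨a, ha⟩ := Projectivization.exists_smul_eq_mk_rep ℂ q hq
  rw [← ha]
  refine exists_congr fun v => ?_
  change HyperosculatesAt ((a • q : QuadForm) : CoordRing) v ↔ _
  rw [hyperosculatesAt_iff q.2, hyperosculatesAt_iff (a • q : QuadForm).2]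
  refine and_congr_right fun _ => and_congr_right fun _ => ?_
  have : ((a • q : QuadForm) : CoordRing) = (a : ℂ) • (q : CoordRing) := rfl
  rw [this, map_smul, Polynomial.smul_eq_C_mul, IsUnit.dvd_mul_left]
  exact Polynomial.isUnit_C.2 a.isUnit

lemma mk_smul_mk_conic (t : GL (Fin 3) ℂ) {q : QuadForm} (hq : q ≠ 0) :
    Matrix.ProjGenLinGroup.mk t • (Projectivization.mk ℂ q hq : Conic) =
      Projectivization.mk ℂ (t • q) ((smul_ne_zero_iff_ne t).2 hq) := rfl

/-- The hyperosculating conic at `(c : 1 : 1)`, as a quadratic form. -/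
def sexticForm (c : ℂ) : QuadForm :=
  ⟨ternaryForm (sexticCoeffs c), isHomogeneous_ternaryForm _⟩

lemma sexticForm_ne_zero (c : ℂ) : sexticForm c ≠ 0 := by
  intro h
  have h0 : ternaryForm (sexticCoeffs c) = ternaryForm 0 := by
    rw [show ternaryForm (sexticCoeffs c) = 0 from congrArg Subtype.val h]
    simp [ternaryForm]
  have := congrFun (ternaryForm_injective h0) 3
  simp [sexticCoeffs] at this

/-- The hyperosculating conic at `(c : 1 : 1)`. -/
def sexticConic (c : ℂ) : Conic := Projectivization.mk ℂ (sexticForm c) (sexticForm_ne_zero c)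

lemma hyperosculatesAt_cons_one_one_iff {c : ℂ} (hc : c ^ 3 = -2) (q : QuadForm) :
    HyperosculatesAt (q : CoordRing) ![c, 1, 1] ↔ ∃ k : ℂ, q = k • sexticForm c := by
  have hc0 : c ≠ 0 := by
    rintro rfl
    norm_num at hc
  have hv : (![c, 1, 1] : Fin 3 → ℂ) ≠ 0 := fun h => hc0 (congrFun h 0)
  have hiff : (∃ k : ℂ, q = k • sexticForm c) ↔
      ∃ k : ℂ, (q : CoordRing) = k • ternaryForm (sexticCoeffs c) :=
    exists_congr fun k => Subtype.ext_iff
  rw [hiff, ← six_le_iff hc hv q.2]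
  refine ⟨fun h => h.2.2.2, fun h => ⟨hv, ?_, by simp [hc]; norm_num, h⟩⟩
  intro i
  fin_cases i <;> simp [hc0]

/-- Every hyperosculating conic of the Fermat cubic is the image of one of them under a monomial
matrix whose entries are cube roots of unity. -/
lemma exists_mk_monomialGL_smul_eq {c : ℂ} (hc : c ^ 3 = -2) {Q : Conic}
    (hQ : IsHyperosculatingConic fermatCubic Q) :
    ∃ (d : Fin 3 → ℂˣ) (k : Fin 3), (∀ i, d i ^ 3 = 1) ∧
      Matrix.ProjGenLinGroup.mk (monomialGL d k) • Q = sexticConic c := by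
  induction Q using Projectivization.ind with | h q hq => ?_
  obtain ⟨v, hv⟩ := (isHyperosculatingConic_mk_iff hq).1 hQ
  have hc0 : c ≠ 0 := by
    rintro rfl
    norm_num at hc
  obtain ⟨k, hk⟩ : ∃ i, v (i + 1) ^ 3 = v (i + 2) ^ 3 := by
    obtain ⟨hv0, h1, h2, h3⟩ := hv
    exact exists_pow_three_eq_of_six_le hv0 h1 h2 q.2 (fun h => hq (Subtype.ext h)) h3
  -- The rotation by `k` brings the two coordinates with equal cubes to positions 1 and 2; rescaling
  -- then makes the middle one equal to 1.
  have hrot := hv.monomialGL_smul (d := 1) (by simp) k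
  have hk1 : v (1 + k) ≠ 0 := by
    simpa using hrot.2.1 1
  have hscale := hrot.const_smul (inv_ne_zero hk1)
  set w : Fin 3 → ℂ := (v (1 + k))⁻¹ • fun i => ((1 : Fin 3 → ℂˣ) i : ℂ) * v (i + k) with hw
  have hw1 : w 1 = 1 := by simp [hw, hk1]
  have hw2 : w 2 ^ 3 = 1 := by
    have : w 2 = (v (1 + k))⁻¹ * v (2 + k) := by simp [hw]
    rw [this, mul_pow, add_comm 2 k, ← hk, add_comm k 1, inv_pow]
    exact inv_mul_cancel₀ (pow_ne_zero 3 hk1)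
  have hw0 : w 0 ^ 3 = -2 := by
    have := hscale.2.2.1
    rw [hw1, hw2] at this
    linear_combination this
  have hn : ∀ i, w i ≠ 0 := hscale.2.1
  -- Chosen to send `w` to `(c, 1, 1)`; the entries are cube roots of unity because `w₀³ = c³ = -2`
  -- and `w₂³ = 1`.
  set d : Fin 3 → ℂˣ := ![Units.mk0 c hc0 * (Units.mk0 _ (hn 0))⁻¹, 1,
    (Units.mk0 _ (hn 2))⁻¹] with hd
  have hd3 : ∀ i, d i ^ 3 = 1 := by
    intro i
    fin_cases i
    · ext
      simp [hd, mul_pow, hc, hw0]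
    · simp [hd]
    · ext
      simp [hd, hw2]
  have hfin := hscale.monomialGL_smul hd3 0
  have hvec : (fun i => (d i : ℂ) * w (i + 0)) = ![c, 1, 1] := by
    ext i
    fin_cases i
    · simp [hd, hn]
    · simp [hd, hw1]
    · simp [hd, hn]
  rw [hvec, hyperosculatesAt_cons_one_one_iff hc, smul_smul, monomialGL_mul] at hfin
  obtain ⟨a, ha⟩ := hfin
  refine ⟨_, _, ?_, (mk_smul_mk_conic _ hq).trans
    ((Projectivization.mk_eq_mk_iff' ℂ _ _ _ _).2 ⟨a, ha.symm⟩)⟩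
  intro i
  simpa using hd3 i

lemma isHyperosculatingConic_mk_monomialGL_smul {Q : Conic}
    (hQ : IsHyperosculatingConic fermatCubic Q) {d : Fin 3 → ℂˣ} (hd : ∀ i, d i ^ 3 = 1)
    (k : Fin 3) :
    IsHyperosculatingConic fermatCubic (Matrix.ProjGenLinGroup.mk (monomialGL d k) • Q) := by
  induction Q using Projectivization.ind with | h q hq => ?_
  obtain ⟨v, hv⟩ := (isHyperosculatingConic_mk_iff hq).1 hQ
  rw [mk_smul_mk_conic, isHyperosculatingConic_mk_iff]
  exact ⟨_, hv.monomialGL_smul hd k⟩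

lemma isHyperosculatingConic_sexticConic {c : ℂ} (hc : c ^ 3 = -2) :
    IsHyperosculatingConic fermatCubic (sexticConic c) := by
  rw [sexticConic, isHyperosculatingConic_mk_iff]
  exact ⟨_, (hyperosculatesAt_cons_one_one_iff hc _).2 ⟨1, (one_smul _ _).symm⟩⟩

/-- Monomial matrices of cube roots of unity that stabilize the conic are scalar. -/
lemma mk_monomialGL_eq_one_of_smul_eq {c : ℂ} (hc : c ^ 3 = -2) {d : Fin 3 → ℂˣ}
    (hd : ∀ i, d i ^ 3 = 1) {k : Fin 3}
    (h : Matrix.ProjGenLinGroup.mk (monomialGL d k) • sexticConic c = sexticConic c) :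
    Matrix.ProjGenLinGroup.mk (monomialGL d k) = 1 := by
  have hd' : ∀ i, (d i : ℂ) ^ 3 = 1 := fun i => by
    rw [← Units.val_pow_eq_pow_val, hd i, Units.val_one]
  have hinv : Matrix.ProjGenLinGroup.mk (monomialGL d k)⁻¹ • sexticConic c = sexticConic c := by
    rw [map_inv, inv_smul_eq_iff, h]
  rw [sexticConic, mk_smul_mk_conic, Projectivization.mk_eq_mk_iff'] at hinv
  obtain ⟨u, hu⟩ := hinv
  have hu' : u • ternaryForm (sexticCoeffs c) =
      substMatrix (monomialMatrix (fun i => d i) k) (ternaryForm (sexticCoeffs c)) := by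
    have := congrArg Subtype.val hu
    rw [coe_smul_quadForm, inv_inv] at this
    exact this
  have key : ∀ w : Fin 3 → ℂ, _ := fun w => congrArg (MvPolynomial.aeval w) hu'
  simp only [map_smul, aeval_substMatrix_monomialMatrix, aeval_ternaryForm] at key
  have hc6 : c ^ 6 = 4 := by linear_combination (c ^ 3 - 2) * hc
  have hc0 : c ≠ 0 := by
    rintro rfl
    norm_num at hc
  have hs : (-4 / c ^ 2) ^ 3 = -16 := by
    rw [div_pow, ← pow_mul, hc6]
    norm_num
  have e0 := key ![1, 0, 0]
  have e1 := key ![0, 1, 0]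
  have e2 := key ![0, 0, 1]
  have hcube : ∀ (i : Fin 3), ((d i : ℂ) ^ 2) ^ 3 = 1 := fun i => by
    rw [← pow_mul, mul_comm, pow_mul, hd', one_pow]
  -- A nontrivial shift would give both equations for the proportionality factor `u`, from two
  -- different square terms; their cubes say `u³ = -16` and `u³ = 1`.
  have habs : ∀ i j : Fin 3, u = -4 / c ^ 2 * (d i : ℂ) ^ 2 → u ≠ (d j : ℂ) ^ 2 := by
    intro i j hi hj
    have h1 := congrArg (· ^ 3) hi
    have h2 := congrArg (· ^ 3) hj
    simp only [mul_pow _ _ 3, hs, hcube] at h1 h2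
    rw [h1] at h2
    norm_num at h2
  fin_cases k
  · simp [sexticCoeffs] at e0 e1 e2
    have e0' : u = (d 0 : ℂ) ^ 2 :=
      mul_left_cancel₀ (div_ne_zero (by norm_num) (pow_ne_zero 2 hc0) : -4 / c ^ 2 ≠ 0)
        (by rw [mul_comm, e0])
    -- Squaring is injective on cube roots of unity, since `dᵢ⁴ = dᵢ`.
    have hdu : ∀ i, u = (d i : ℂ) ^ 2 → (d i : ℂ) = u ^ 2 := by
      rintro i rfl
      linear_combination -(d i : ℂ) * hd' i
    have hconst : d = fun _ => d 0 := by
      ext i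
      rw [hdu 0 e0']
      fin_cases i
      · exact hdu 0 e0'
      · exact hdu 1 e1
      · exact hdu 2 e2
    rw [hconst]
    exact (congrArg _ (monomialGL_const (d 0))).trans (Matrix.ProjGenLinGroup.mk_scalar _)
  · simp [sexticCoeffs] at e0 e1 e2
    exact absurd e2 (habs 0 1 e1)
  · simp [sexticCoeffs] at e0 e1 e2
    exact absurd e1 (habs 0 2 e2)

/-- The classes of monomial matrices of cube roots of unity with cyclic support. -/
def monomialSubgroup : Subgroup PGL(3, ℂ) where
  carrier := {t | ∃ (d : Fin 3 → ℂˣ) (k : Fin 3), (∀ i, d i ^ 3 = 1) ∧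
    t = Matrix.ProjGenLinGroup.mk (monomialGL d k)}
  mul_mem' := by
    rintro _ _ ⟨d, k, hd, rfl⟩ ⟨e, l, he, rfl⟩
    exact ⟨fun i => d i * e (i + k), k + l, fun i => by rw [mul_pow, hd, he, one_mul],
      by rw [← map_mul, monomialGL_mul]⟩
  one_mem' := ⟨1, 0, by simp, by rw [monomialGL_one_zero, map_one]⟩
  inv_mem' := by
    rintro _ ⟨d, k, hd, rfl⟩
    exact ⟨fun i => (d (i - k))⁻¹, -k, fun i => by rw [inv_pow, hd, inv_one],
      by rw [← map_inv, monomialGL_inv]⟩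

lemma diagAut_eq_mk (a b c : ℂˣ) :
    diagAut a b c = Matrix.ProjGenLinGroup.mk (monomialGL ![a, b, c] 0) := by
  rw [diagAut]
  congr 1
  ext i j
  fin_cases i <;> fin_cases j <;> simp [monomialGL, monomialMatrix]

lemma permAut_eq_mk {σ : Equiv.Perm (Fin 3)} {k : Fin 3} (h : ∀ i, σ i = i + k) :
    permAut σ = Matrix.ProjGenLinGroup.mk (monomialGL 1 k) := by
  rw [permAut]
  congr 1
  ext i j
  simp [monomialGL, monomialMatrix, Equiv.Perm.permMatrix, PEquiv.toMatrix_apply, h, eq_comm]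

lemma monomialGL_zero_pow (d : Fin 3 → ℂˣ) (n : ℕ) :
    monomialGL d 0 ^ n = monomialGL (d ^ n) 0 := by
  induction n with
  | zero => rw [pow_zero, pow_zero, monomialGL_one_zero]
  | succ n ih =>
    rw [pow_succ, ih, monomialGL_mul, pow_succ, add_zero]
    congr 1
    ext i
    simp

lemma monomialGL_one_pow (k : Fin 3) (n : ℕ) :
    monomialGL 1 k ^ n = monomialGL 1 (n • k) := by
  induction n with
  | zero => rw [pow_zero, zero_smul, monomialGL_one_zero]
  | succ n ih =>
    rw [pow_succ, ih, monomialGL_mul, succ_nsmul]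
    congr 1
    ext i
    simp

/-- On three points, the permutations without fixed points are the nonzero translations. -/
lemma exists_forall_apply_eq_add {γ : Equiv.Perm (Fin 3)} (hγ : γ.IsThreeCycle) :
    ∃ k, k ≠ 0 ∧ ∀ i, γ i = i + k := by
  have hfix : ∀ i, γ i ≠ i := by
    have h3 : γ.support = Finset.univ :=
      (Finset.card_eq_iff_eq_univ _).1 (by rw [hγ.card_support, Fintype.card_fin])
    intro i
    rw [← Equiv.Perm.mem_support, h3]
    exact Finset.mem_univ i
  clear hγ
  revert γ
  decide

lemma exists_nsmul_eq {k : Fin 3} (hk : k ≠ 0) (l : Fin 3) : ∃ n : ℕ, l = n • k := by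
  have h : ∀ k l : Fin 3, k ≠ 0 → ∃ n : Fin 3, l = (n : ℕ) • k := by decide
  obtain ⟨n, hn⟩ := h k l hk
  exact ⟨n, hn⟩

lemma exists_eq_pow {ω : ℂˣ} (hω : IsPrimitiveRoot ω 3) {u : ℂˣ} (hu : u ^ 3 = 1) :
    ∃ n < 3, u = ω ^ n := by
  have h := IsPrimitiveRoot.coe_units_iff.2 hω
  obtain ⟨n, hn, hn'⟩ := h.eq_pow_of_pow_eq_one
    (by rw [← Units.val_pow_eq_pow_val, hu, Units.val_one] : (u : ℂ) ^ 3 = 1)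
  exact ⟨n, hn, Units.ext (by rw [← hn', Units.val_pow_eq_pow_val])⟩

lemma mk_monomialGL_mem_groupG' {ω : ℂˣ} {γ : Equiv.Perm (Fin 3)} (hγ : γ.IsThreeCycle)
    (m n : ℕ) (k : Fin 3) :
    Matrix.ProjGenLinGroup.mk (monomialGL ![ω ^ m, ω ^ n, 1] k) ∈ groupG' ω γ := by
  obtain ⟨k₀, hk₀, hγk⟩ := exists_forall_apply_eq_add hγ
  obtain ⟨l, rfl⟩ := exists_nsmul_eq hk₀ k
  have h : monomialGL ![ω ^ m, ω ^ n, 1] (l • k₀) =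
      monomialGL ![ω, 1, 1] 0 ^ m * monomialGL ![1, ω, 1] 0 ^ n * monomialGL 1 k₀ ^ l := by
    rw [monomialGL_zero_pow, monomialGL_zero_pow, monomialGL_one_pow, monomialGL_mul,
      monomialGL_mul, add_zero, zero_add]
    congr 1
    ext i
    fin_cases i <;> simp
  rw [h, map_mul, map_mul, map_pow, map_pow, map_pow, ← diagAut_eq_mk, ← diagAut_eq_mk,
    ← permAut_eq_mk hγk]
  refine Subgroup.mul_mem _ (Subgroup.mem_sup_left (Subgroup.mul_mem _ ?_ ?_))
    (Subgroup.mem_sup_right (Subgroup.pow_mem _ (Subgroup.mem_zpowers _) _))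
  · exact Subgroup.pow_mem _ (Subgroup.subset_closure (by simp)) _
  · exact Subgroup.pow_mem _ (Subgroup.subset_closure (by simp)) _

/-- Dividing by the scalar `d 2` normalizes the last entry to 1. The resulting normal form is
unique, which gives the order `3 · 3 · 3`. -/
lemma exists_mk_monomialGL_eq {ω : ℂˣ} (hω : IsPrimitiveRoot ω 3) {d : Fin 3 → ℂˣ}
    (hd : ∀ i, d i ^ 3 = 1) (k : Fin 3) : ∃ m < 3, ∃ n < 3,
      Matrix.ProjGenLinGroup.mk (monomialGL d k) =
        Matrix.ProjGenLinGroup.mk (monomialGL ![ω ^ m, ω ^ n, 1] k) := by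
  obtain ⟨m, hm, hm'⟩ := exists_eq_pow hω
    (by rw [mul_pow, inv_pow, hd, hd, inv_one, one_mul] : (d 0 * (d 2)⁻¹) ^ 3 = 1)
  obtain ⟨n, hn, hn'⟩ := exists_eq_pow hω
    (by rw [mul_pow, inv_pow, hd, hd, inv_one, one_mul] : (d 1 * (d 2)⁻¹) ^ 3 = 1)
  refine ⟨m, hm, n, hn, mk_monomialGL_eq_iff.2 ⟨rfl, (d 2)⁻¹, fun i => ?_⟩⟩
  fin_cases i
  · exact hm'
  · exact hn'
  · exact mul_inv_cancel _

/-- Replaces generators by an explicit list of elements, independent of `ω` and `γ`. -/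
lemma groupG'_eq_monomialSubgroup {ω : ℂˣ} (hω : IsPrimitiveRoot ω 3) {γ : Equiv.Perm (Fin 3)}
    (hγ : γ.IsThreeCycle) : groupG' ω γ = monomialSubgroup := by
  apply le_antisymm
  · rw [groupG', groupG, sup_le_iff, Subgroup.closure_le, Subgroup.zpowers_le]
    refine ⟨?_, ?_⟩
    · rintro t (rfl | rfl)
      · refine ⟨_, _, fun i => ?_, diagAut_eq_mk _ _ _⟩
        fin_cases i <;> simp [hω.pow_eq_one]
      · refine ⟨_, _, fun i => ?_, diagAut_eq_mk _ _ _⟩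
        fin_cases i <;> simp [hω.pow_eq_one]
    · obtain ⟨k, -, hk⟩ := exists_forall_apply_eq_add hγ
      exact ⟨1, k, by simp, permAut_eq_mk hk⟩
  · rintro _ ⟨d, k, hd, rfl⟩
    obtain ⟨m, -, n, -, h⟩ := exists_mk_monomialGL_eq hω hd k
    rw [h]
    exact mk_monomialGL_mem_groupG' hγ m n k

lemma card_monomialSubgroup {ω : ℂˣ} (hω : IsPrimitiveRoot ω 3) :
    Nat.card monomialSubgroup = 27 := by
  let f : Fin 3 × Fin 3 × Fin 3 → PGL(3, ℂ) := fun x =>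
    Matrix.ProjGenLinGroup.mk (monomialGL ![ω ^ (x.1 : ℕ), ω ^ (x.2.1 : ℕ), 1] x.2.2)
  have hf : Function.Injective f := by
    rintro ⟨a, b, k⟩ ⟨a', b', k'⟩ h
    obtain ⟨rfl, u, hu⟩ := mk_monomialGL_eq_iff.1 h
    have hu1 : u = 1 := by simpa using hu 2
    have ha : ω ^ (a : ℕ) = ω ^ (a' : ℕ) := by simpa [hu1] using hu 0
    have hb : ω ^ (b : ℕ) = ω ^ (b' : ℕ) := by simpa [hu1] using hu 1
    rw [Fin.ext (hω.pow_inj a.2 a'.2 ha), Fin.ext (hω.pow_inj b.2 b'.2 hb)]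
  have hrange : (monomialSubgroup : Set PGL(3, ℂ)) = Set.range f := by
    ext t
    constructor
    · rintro ⟨d, k, hd, rfl⟩
      obtain ⟨m, hm, n, hn, h⟩ := exists_mk_monomialGL_eq hω hd k
      exact ⟨(⟨m, hm⟩, ⟨n, hn⟩, k), h.symm⟩
    · rintro ⟨⟨a, b, k⟩, rfl⟩
      refine ⟨_, _, fun i => ?_, rfl⟩
      fin_cases i <;> simp [← pow_mul, mul_comm _ 3] <;> simp [pow_mul, hω.pow_eq_one]
  have h : Nat.card monomialSubgroup = Nat.card (Set.range f) := by
    rw [← hrange]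
    rfl
  rw [h, Nat.card_range_of_injective hf]
  simp

lemma hyperosculatingConics_eq_orbit {c : ℂ} (hc : c ^ 3 = -2) :
    hyperosculatingConics fermatCubic = MulAction.orbit monomialSubgroup (sexticConic c) := by
  ext Q
  constructor
  · intro hQ
    obtain ⟨d, k, hd, h⟩ := exists_mk_monomialGL_smul_eq hc hQ
    rw [MulAction.mem_orbit_symm]
    exact ⟨⟨_, d, k, hd, rfl⟩, h⟩
  · rintro ⟨⟨_, d, k, hd, rfl⟩, rfl⟩
    exact isHyperosculatingConic_mk_monomialGL_smul (isHyperosculatingConic_sexticConic hc) hd k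

end

end FermatConics


theorem corollary4p3 (ω : ℂˣ) (hω : IsPrimitiveRoot ω 3)
    (γ : Equiv.Perm (Fin 3)) (hγ : γ.IsThreeCycle) :
    (hyperosculatingConics fermatCubic).ncard = 27 ∧
    -- the action of `G'` on the set of hyperosculating conics, and its freeness
    (∀ t ∈ groupG' ω γ, t • hyperosculatingConics fermatCubic =
      hyperosculatingConics fermatCubic) ∧
    (∀ t ∈ groupG' ω γ, ∀ Q ∈ hyperosculatingConics fermatCubic, t • Q = Q → t = 1) ∧
    -- the action of `G'` on the set of unordered pairs of these conics, and its freeness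
    (∀ t ∈ groupG' ω γ, ∀ P ∈ unorderedPairs (hyperosculatingConics fermatCubic),
      t • P ∈ unorderedPairs (hyperosculatingConics fermatCubic)) ∧
    (∀ t ∈ groupG' ω γ, ∀ P ∈ unorderedPairs (hyperosculatingConics fermatCubic),
      t • P = P → t = 1) ∧
    -- the number of orbits of pairs
    (MulAction.orbit (groupG' ω γ) ''
      unorderedPairs (hyperosculatingConics fermatCubic)).ncard = 13 := by
  -- This places `(c : 1 : 1)` on the cubic, the base point of the orbit.
  obtain ⟨c, hc⟩ := IsAlgClosed.exists_pow_nat_eq (-2 : ℂ) (show 0 < 3 by norm_num)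
  have hcard := card_monomialSubgroup hω
  have hfix : ∀ t ∈ monomialSubgroup, t • sexticConic c = sexticConic c → t = 1 := by
    rintro _ ⟨d, k, hd, rfl⟩ h
    exact mk_monomialGL_eq_one_of_smul_eq hc hd h
  have hodd : Odd (Nat.card monomialSubgroup) := by
    rw [hcard]
    decide
  rw [groupG'_eq_monomialSubgroup hω hγ, hyperosculatingConics_eq_orbit hc]
  refine ⟨by rw [ncard_orbit_of_free hfix, hcard], fun t ht => smul_orbit_of_mem ht,
    fun t ht Q hQ h => eq_one_of_smul_eq_of_mem_orbit hfix ht hQ h,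
    fun t ht P hP => smul_mem_unorderedPairs ht hP,
    fun t ht P hP h => eq_one_of_smul_pair_eq hodd hfix ht hP h, ?_⟩
  have h := ncard_image_orbit_unorderedPairs hodd hfix
    (Nat.finite_of_card_ne_zero (by rw [hcard]; norm_num))
  rw [hcard] at h
  have h2 : Nat.choose 27 2 = 13 * 27 := by decide
  rw [h2] at h
  exact Nat.eq_of_mul_eq_mul_right (by norm_num) h
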